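/- **Intersection model.** Let $G=(V,E)$ be a directed graph of collision points with edge lengths $d(u,v)>0$, with disjoint sets of entry lanes and exit lanes in $V$, and let $a_1,\dots,a_M$ be finitely many agents. Agent $a_i$ has a length $L_i>0$, an earliest start time $e_i\ge 0$, and a predefined simple path $c_i^0,\dots,c_i^{m_i}$ in $G$ from an entry lane to an exit lane; $d_i^q$ is the travel distance from $c_i^0$ to $c_i^q$. Let $\omega>0$, $K\ge 1$, and let $\underline U_i^k,\overline U_i^k$ ($1\le k\le K$) be constants with $0<\underline U_i^1\le\overline U_i^1$ and $\underline U_i^k\le 0\le\overline U_i^k$ for $k\ge 2$. A trajectory of $a_i$ consists of an entry time $s_i\ge e_i$ (before which it waits in front of its entry lane), an arrival time $T_i>s_i$ and a $K$ times continuously differentiable travelled distance $\ell_i$ on $[s_i,T_i]$ with $\ell_i(s_i)=0$, $\ell_i(T_i)=d_i^{m_i}$, $\underline U_i^k\le \ell_i^{(k)}\le\overline U_i^k$ for $1\le k\le K$, $\ell_i'(s_i)=\underline U_i^1$ and $\ell_i^{(k)}(s_i)=0$ for $2\le k\le K$; after $T_i$ the agent keeps its speed. It reaches $c_i^q$ at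 the first time $t_i(c_i^q)$ at which $\ell_i\ge d_i^q$, and occupies it until $t_i(c_i^q)+\tau_i(c_i^q)$, which is $L_i/\omega$ after the first time at which $\ell_i\ge d_i^q+L_i$. Agents $a_i\ne a_j$ collide if for a common collision point $c$ the intervals $[t_i(c),t_i(c)+\tau_i(c))$ and $[t_j(c),t_j(c)+\tau_j(c))$ overlap. If $a_i,a_j$ have the same entry lane and $e_i<e_j$, an overtake happens if $t_i(c)\ge t_j(c)$ for some common collision point $c$. A solution is a family of trajectories, one for each agent, without collisions and overtakes. **The planner PSB.** *Level 1 (priority-based search).* Depth-first search of a binary priority tree. A node holds priority orderings and trajectories. The orderings of the root put $a_i$ before $a_j$ whenever they have the same entry lane and $e_i<e_j$. To generate a node, Level 2 is called for the agents one after the other, each after all agents of higher priority (in the transitive closure of the orderings); the node is discarded if Level 2 fails or if the orderings are cyclic. If the trajectories of the visited node are free of collisions, they are returned; otherwise some colliding pair $a_i,a_j$ is chosen, and two children are generated, with the additional ordering of $a_i$ before $a_j$ and of $a_j$ before $a_i$ respectively. *Level 2 (extended SIPP).* The safe intervals of $a_i$ at a collision point $c$ of its path are what remains of $[e_i,\infty)$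 after the removal of $[t_j(c),t_j(c)+\tau_j(c))$ for each $a_j$ of higher priority, and of all times before $t_j(c)+\tau_j(c)$ if moreover $a_j$ has the same entry lane and $e_j<e_i$. A search node consists of intervals for $c_i^0,\dots,c_i^q$; initially there is one node for each safe interval at $c_i^0$. A node whose last interval is $[lb,ub)$ is expanded by the nonempty intersections of $[lb+d/\overline U_i^1,\,ub+d/\underline U_i^1)$, $d=d(c_i^q,c_i^{q+1})$, with the safe intervals at $c_i^{q+1}$. Always an open node of least value $f=lb+(d_i^{m_i}-d_i^q)/\overline U_i^1$ is taken; for a node at the goal, Level 3 is called, and its result is kept if it arrives earlier than the best one so far. The search ends when no open node has an $f$ smaller than the best arrival time. *Level 3 (BCP).* Given intervals $[lb^j,ub^j)$ for $j=0,\dots,m_i$ and an arrival time $T$, let $\delta_T^*$ be the infimum of the slack $\delta\ge 0$ over all $s<T$ and all Bézier curves $B$ of degree $n$ on $[s,T]$, continued after $T$ with constant speed and by $0$ before $s$, with nondecreasing control points, $B(s)=0$, $B(T)=d_i^{m_i}$, initial derivatives as above, $B(lb^j)\le d_i^j+\delta$ for all $j$, $B(ub^j-L_i/\omega)>d_i^j+L_i-\delta$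 for all $j$ with $ub^j<\infty$, and all control points of the $k$-th derivative in $[\underline U_i^k-\delta,\overline U_i^k+\delta]$ for $1\le k\le K$. Put $\nabla\delta_T^*=(\delta_{T+\Delta}^*-\delta_T^*)/\Delta$. Start with $T_{lb}=lb^{m_i}$, and with $T_{ub}=ub^{m_i}$ if this is finite and $T_{ub}=\max_{j}(lb^j-d_i^j/\underline U_i^1)+(d_i^{m_i}+L_i)/\underline U_i^1$ otherwise. Fail unless $\nabla\delta^*_{T_{lb}}\le 0\le\nabla\delta^*_{T_{ub}}$. While $T_{ub}-T_{lb}>\epsilon$, let $T_{mid}$ be the midpoint: if a curve with arrival time $T_{mid}$ and slack $0$ exists, keep one and set $T_{ub}=T_{mid}$; otherwise set $T_{ub}=T_{mid}$ if $\nabla\delta^*_{T_{mid}}>0$, and $T_{lb}=T_{mid}$ if not. Return the last curve kept, or fail if there is none. **Theorem 2 (Completeness and suboptimality of PSB).** Let $n\ge 1$, $\Delta>0$ and $0<\epsilon<L_i/\underline U_i^1$ for all $i$. On every instance of the intersection model, and whatever choices are made where the description leaves them open (order of the agents and of sibling nodes, colliding pairs, ties, Bézier curves of slack $0$), PSB stops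 after finitely many steps and returns a solution, i.e. kinodynamically feasible trajectories of all agents without collisions and overtakes. Here a step is an elementary step of one of the three levels, in which the optimization problems of Level 3 count as solved exactly. The solution need not be optimal. -/

import Mathlib

namespace PSB

noncomputable section

/-! ### The intersection model -/

/-- An intersection with a family `ι` of agents, and bounds on the derivatives of the travelled
distance up to order `K`. -/
structure Intersection (V ι : Type*) (K : ℕ) where
  /-- the directed graph on the collision points -/
  graph : Digraph V
  /-- the travel distance along an edge -/
  edgeDist : V → V → ℝ
  edgeDist_pos : ∀ u v, graph.Adj u v → 0 < edgeDist u v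
  entryLanes : Set V
  exitLanes : Set V
  lanes_disjoint : Disjoint entryLanes exitLanes
  /-- the predefined path of agent `i` is `path i 0, …, path i (len i)` -/
  len : ι → ℕ
  path : ι → ℕ → V
  path_adj : ∀ i q, q < len i → graph.Adj (path i q) (path i (q + 1))
  /-- a path visits a collision point at most once, so that there is one time of reaching it -/
  path_simple : ∀ i, Set.InjOn (path i) (Set.Iic (len i))
  path_start : ∀ i, path i 0 ∈ entryLanes
  path_goal : ∀ i, path i (len i) ∈ exitLanes
  /-- the length of the agent -/
  length : ι → ℝ
  length_pos : ∀ i, 0 < length i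
  /-- the earliest start time of the agent -/
  earliest : ι → ℝ
  earliest_nonneg : ∀ i, 0 ≤ earliest i
  /-- bounds for the `k`-th derivative of the travelled distance, `1 ≤ k ≤ K` -/
  lo : ι → ℕ → ℝ
  hi : ι → ℕ → ℝ
  order_pos : 1 ≤ K
  minSpeed_pos : ∀ i, 0 < lo i 1
  speed_le : ∀ i, lo i 1 ≤ hi i 1
  higher_bounds : ∀ i k, 2 ≤ k → k ≤ K → lo i k ≤ 0 ∧ 0 ≤ hi i k
  /-- the constant derived from the wave speed -/
  waveSpeed : ℝ
  waveSpeed_pos : 0 < waveSpeed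

/-- A spatio-temporal profile along a given path: the agent waits before its entry lane until time
`start`, has travelled the distance `dist t` at each time `t` of `[start, arrival]`, and reaches
its goal at time `arrival`. -/
structure Profile where
  start : ℝ
  arrival : ℝ
  dist : ℝ → ℝ

/-- Position of the front of the agent at time `t`. Beyond its goal the agent keeps the speed
that it has on arrival, until its whole length has left the intersection. -/
def Profile.pos (P : Profile) (t : ℝ) : ℝ :=
  if t < P.start then 0
  else if t ≤ P.arrival then P.dist t
  else P.dist P.arrival +
    derivWithin P.dist (Set.Icc P.start P.arrival) P.arrival * (t - P.arrival)

namespace Intersection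

variable {V ι : Type*} {K : ℕ} (I : Intersection V ι K)

/-- Travel distance from the start to the `q`-th collision point of the path of agent `i`. -/
def travel (i : ι) (q : ℕ) : ℝ :=
  ∑ r ∈ Finset.range q, I.edgeDist (I.path i r) (I.path i (r + 1))

/-- Travel distance from the start to the goal. -/
def total (i : ι) : ℝ := I.travel i (I.len i)

/-- Initial derivatives: an agent enters at its minimum speed, all higher derivatives being 0. -/
def initial (i : ι) (k : ℕ) : ℝ := if k = 1 then I.lo i 1 else 0

/-- The time at which agent `i` reaches the `q`-th collision point of its path. -/
def reach (i : ι) (P : Profile) (q : ℕ) : ℝ :=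
  sInf {t | P.start ≤ t ∧ I.travel i q ≤ P.pos t}

/-- The time from which on the `q`-th collision point of its path is no longer occupied by agent
`i`: its rear has passed the point, and the time `L / ω` has elapsed since. -/
def leave (i : ι) (P : Profile) (q : ℕ) : ℝ :=
  sInf {t | P.start ≤ t ∧ I.travel i q + I.length i ≤ P.pos t} + I.length i / I.waveSpeed

/-- `P` satisfies the kinodynamic constraints of agent `i` and takes it from its start, not
earlier than its earliest start time, to its goal. -/
structure IsKinodynamic (i : ι) (P : Profile) : Prop where
  earliest_le : I.earliest i ≤ P.start
  start_lt : P.start < P.arrival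
  dist_start : P.dist P.start = 0
  dist_arrival : P.dist P.arrival = I.total i
  contDiff : ContDiffOn ℝ K P.dist (Set.Icc P.start P.arrival)
  initial : ∀ k, 1 ≤ k → k ≤ K →
    iteratedDerivWithin k P.dist (Set.Icc P.start P.arrival) P.start = I.initial i k
  bounds : ∀ k, 1 ≤ k → k ≤ K → ∀ t ∈ Set.Icc P.start P.arrival,
    I.lo i k ≤ iteratedDerivWithin k P.dist (Set.Icc P.start P.arrival) t ∧
    iteratedDerivWithin k P.dist (Set.Icc P.start P.arrival) t ≤ I.hi i k

/-- Agents `i` and `j` collide: their occupation times of a common collision point overlap. -/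
def Collide (traj : ι → Profile) (i j : ι) : Prop :=
  i ≠ j ∧ ∃ q ≤ I.len i, ∃ r ≤ I.len j, I.path i q = I.path j r ∧
    ¬ Disjoint (Set.Ico (I.reach i (traj i) q) (I.leave i (traj i) q))
      (Set.Ico (I.reach j (traj j) r) (I.leave j (traj j) r))

/-- Agent `i` comes from the same entry lane as agent `j`, with an earlier start time. -/
def Ahead (i j : ι) : Prop :=
  I.path i 0 = I.path j 0 ∧ I.earliest i < I.earliest j

/-- Agent `j` overtakes agent `i`. -/
def Overtake (traj : ι → Profile) (i j : ι) : Prop :=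
  I.Ahead i j ∧ ∃ q ≤ I.len i, ∃ r ≤ I.len j, I.path i q = I.path j r ∧
    I.reach j (traj j) r ≤ I.reach i (traj i) q

/-- Solutions of the motion planning problem on the intersection. -/
structure IsSolution (traj : ι → Profile) : Prop where
  kinodynamic : ∀ i, I.IsKinodynamic i (traj i)
  collisionFree : ∀ i j, ¬ I.Collide traj i j
  overtakeFree : ∀ i j, ¬ I.Overtake traj i j

end Intersection

/-! ### Level 3: the Bézier-curve-based planner -/

/-- The Bézier curve of degree `n` on `[0, D]` with control points `p 0, …, p n`. -/
def bezier (n : ℕ) (D : ℝ) (p : ℕ → ℝ) (x : ℝ) : ℝ :=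
  ∑ r ∈ Finset.range (n + 1), p r * ((n.choose r : ℝ) * (x / D) ^ r * ((D - x) / D) ^ (n - r))

/-- The `r`-th control point of the `k`-th derivative of `bezier n D p` (for `r + k ≤ n`). -/
def ctrl (n : ℕ) (D : ℝ) (p : ℕ → ℝ) (k r : ℕ) : ℝ :=
  (n.descFactorial k : ℝ) / D ^ k *
    ∑ j ∈ Finset.range (k + 1), (-1) ^ j * (k.choose j : ℝ) * p (r + k - j)

/-- Enter at time `s`, then follow the Bézier curve with control points `p` until time `T`. -/
def bezierProfile (n : ℕ) (p : ℕ → ℝ) (s T : ℝ) : Profile where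
  start := s
  arrival := T
  dist t := bezier n (T - s) p (t - s)

/-- A time interval `[lb, ub)`, where `ub` may be infinite. -/
structure TimeInterval where
  lb : ℝ
  ub : WithTop ℝ

namespace Intersection

variable {V ι : Type*} {K : ℕ} (I : Intersection V ι K)

/-- The constraints of the optimization problem of Level 3 for the arrival time `T`, in the entry
time `s`, the control points `p` and the slack `δ`; the collision point number `j` has to be
passed within the time interval `S j`. For fixed `s` it is a linear program in `p` and `δ`. The
control points do not decrease, as the curve stands for a travelled distance. -/
structure SlackFeasible (n : ℕ) (i : ι) (S : ℕ → TimeInterval) (T s : ℝ) (p : ℕ → ℝ) (δ : ℝ) :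
    Prop where
  slack_nonneg : 0 ≤ δ
  start_lt : s < T
  first : p 0 = 0
  last : p n = I.total i
  initial : ∀ k, 1 ≤ k → k ≤ K → ctrl n (T - s) p k 0 = I.initial i k
  monotone : ∀ r, r < n → p r ≤ p (r + 1)
  not_early : ∀ j ≤ I.len i, (bezierProfile n p s T).pos (S j).lb ≤ I.travel i j + δ
  not_late : ∀ j ≤ I.len i, ∀ u : ℝ, (S j).ub = (u : WithTop ℝ) →
    I.travel i j + I.length i - δ < (bezierProfile n p s T).pos (u - I.length i / I.waveSpeed)
  bounds : ∀ k, 1 ≤ k → k ≤ K → ∀ r, r + k ≤ n →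
    I.lo i k - δ ≤ ctrl n (T - s) p k r ∧ ctrl n (T - s) p k r ≤ I.hi i k + δ

/-- `P` is a Bézier profile with arrival time `T` that is feasible with slack zero. -/
def IsZeroSlack (n : ℕ) (i : ι) (S : ℕ → TimeInterval) (T : ℝ) (P : Profile) : Prop :=
  ∃ s p, P = bezierProfile n p s T ∧ I.SlackFeasible n i S T s p 0

/-- The optimal slack for the arrival time `T`. -/
def optSlack (n : ℕ) (i : ι) (S : ℕ → TimeInterval) (T : ℝ) : ℝ :=
  sInf {δ | ∃ s p, I.SlackFeasible n i S T s p δ}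

/-- The gradient of the optimal slack, as a difference quotient with increment `Δ`. -/
def gradSlack (n : ℕ) (Δ : ℝ) (i : ι) (S : ℕ → TimeInterval) (T : ℝ) : ℝ :=
  (I.optSlack n i S (T + Δ) - I.optSlack n i S T) / Δ

/-- The initial upper bound of the search. If the last interval is unbounded, it is the minimum
of `t + (d + L) / U`, with `d` the length of the path and `U` the minimum speed, over the `t`
such that the agent is nowhere early when it enters at time `t` and keeps its minimum speed. -/
def upperBound (i : ι) (S : ℕ → TimeInterval) : ℝ :=
  match (S (I.len i)).ub with
  | (u : ℝ) => u
  | ⊤ => (Finset.range (I.len i + 1)).sup' Finset.nonempty_range_add_one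
        (fun j => (S j).lb - I.travel i j / I.lo i 1) + (I.total i + I.length i) / I.lo i 1

end Intersection

/-- States of Level 3: initial state, binary search (bounds and best profile so far), result. -/
inductive BCPState where
  | start
  | search (Tlb Tub : ℝ) (best : Option Profile)
  | done (result : Option Profile)

/-- The steps of Level 3, with `n + 1` control points, tolerance `ε` and increment `Δ`, for agent
`i` and the time intervals `S`. -/
inductive BCPStep {V ι : Type*} {K : ℕ} (I : Intersection V ι K) (n : ℕ) (ε Δ : ℝ) (i : ι)
    (S : ℕ → TimeInterval) : BCPState → BCPState → Prop
  | init : I.gradSlack n Δ i S (S (I.len i)).lb ≤ 0 → 0 ≤ I.gradSlack n Δ i S (I.upperBound i S) →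
      BCPStep I n ε Δ i S .start (.search (S (I.len i)).lb (I.upperBound i S) none)
  | noSolution :
      ¬ (I.gradSlack n Δ i S (S (I.len i)).lb ≤ 0 ∧ 0 ≤ I.gradSlack n Δ i S (I.upperBound i S)) →
      BCPStep I n ε Δ i S .start (.done none)
  | feasible (Tlb Tub : ℝ) (best : Option Profile) (P : Profile) : ε < Tub - Tlb →
      I.IsZeroSlack n i S ((Tlb + Tub) / 2) P →
      BCPStep I n ε Δ i S (.search Tlb Tub best) (.search Tlb ((Tlb + Tub) / 2) (some P))
  | left (Tlb Tub : ℝ) (best : Option Profile) : ε < Tub - Tlb →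
      (¬ ∃ P, I.IsZeroSlack n i S ((Tlb + Tub) / 2) P) →
      0 < I.gradSlack n Δ i S ((Tlb + Tub) / 2) →
      BCPStep I n ε Δ i S (.search Tlb Tub best) (.search Tlb ((Tlb + Tub) / 2) best)
  | right (Tlb Tub : ℝ) (best : Option Profile) : ε < Tub - Tlb →
      (¬ ∃ P, I.IsZeroSlack n i S ((Tlb + Tub) / 2) P) →
      I.gradSlack n Δ i S ((Tlb + Tub) / 2) ≤ 0 →
      BCPStep I n ε Δ i S (.search Tlb Tub best) (.search ((Tlb + Tub) / 2) Tub best)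
  | halt (Tlb Tub : ℝ) (best : Option Profile) : Tub - Tlb ≤ ε →
      BCPStep I n ε Δ i S (.search Tlb Tub best) (.done best)

/-! ### Level 2: extended safe interval path planning -/

/-- The nonempty ones of the at most two intervals that remain of `J` without `[b.1, b.2)`. -/
def TimeInterval.remove (J : TimeInterval) (b : ℝ × ℝ) : List TimeInterval :=
  open Classical in
  [⟨J.lb, min J.ub (b.1 : WithTop ℝ)⟩, ⟨max J.lb b.2, J.ub⟩].filter
    (fun J' => (J'.lb : WithTop ℝ) < J'.ub)

/-- A node of the Level 2 search: the collision points with numbers `0, …, depth` of the path,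
where number `j` is to be passed within the time interval `ivl j`. -/
structure SIPPNode where
  depth : ℕ
  ivl : ℕ → TimeInterval

namespace Intersection

variable {V ι : Type*} {K : ℕ} (I : Intersection V ι K)

/-- The time intervals at the `q`-th collision point of agent `i` that are blocked by the agents
whose trajectories are given by `H`. An agent that starts ahead of `i` on the same entry lane
blocks all the time until it leaves the point, as it must not be overtaken. -/
def blocks [Fintype ι] (H : ι → Option Profile) (i : ι) (q : ℕ) : List (ℝ × ℝ) :=
  open Classical in
  (Finset.univ : Finset ι).toList.flatMap fun j =>
    match H j with
    | none => []
    | some P =>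
      ((List.range (I.len j + 1)).filter (fun r => I.path j r = I.path i q)).map fun r =>
        (if I.Ahead j i then min (I.earliest i) (I.reach j P r) else I.reach j P r,
          I.leave j P r)

/-- The safe intervals of agent `i` at the `q`-th collision point of its path. -/
def safeIntervals [Fintype ι] (H : ι → Option Profile) (i : ι) (q : ℕ) : List TimeInterval :=
  (I.blocks H i q).foldl (fun Js b => Js.flatMap (fun J => J.remove b)) [⟨I.earliest i, ⊤⟩]

/-- The lower bound for the arrival time: the lower bound of the last interval plus the minimum
travel time from there to the goal. -/
def fValue (i : ι) (N : SIPPNode) : ℝ :=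
  (N.ivl N.depth).lb + (I.total i - I.travel i N.depth) / I.hi i 1

/-- Move on to the next collision point in its safe interval `J`, with the speed freely adjustable
between its bounds; `none` if `J` cannot be met. -/
def extend (i : ι) (N : SIPPNode) (J : TimeInterval) : Option SIPPNode :=
  open Classical in
  let d := I.edgeDist (I.path i N.depth) (I.path i (N.depth + 1))
  let lb := max J.lb ((N.ivl N.depth).lb + d / I.hi i 1)
  let ub := min J.ub ((N.ivl N.depth).ub + ((d / I.lo i 1 : ℝ) : WithTop ℝ))
  if (lb : WithTop ℝ) < ub then
    some ⟨N.depth + 1, Function.update N.ivl (N.depth + 1) ⟨lb, ub⟩⟩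
  else none

/-- The child nodes of a node. -/
def expand [Fintype ι] (H : ι → Option Profile) (i : ι) (N : SIPPNode) : Multiset SIPPNode :=
  ((I.safeIntervals H i (N.depth + 1)).filterMap (I.extend i N) : List SIPPNode)

end Intersection

/-- The value `x` is smaller than the arrival time of the best profile so far, if there is one. -/
def Improves : Option Profile → ℝ → Prop
  | none, _ => True
  | some P, x => x < P.arrival

/-- The better one of the best profile so far and a result of Level 3. -/
def keepBest (best : Option Profile) : Option Profile → Option Profile
  | none => best
  | some P => open Classical in if Improves best P.arrival then some P else best

/-- States of Level 2: search (open list and best profile so far), call of Level 3 for a goal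
node, result. -/
inductive SIPPState where
  | search (opn : Multiset SIPPNode) (best : Option Profile)
  | level3 (opn : Multiset SIPPNode) (best : Option Profile) (N : SIPPNode) (b : BCPState)
  | done (result : Option Profile)

/-- Initially there is one node for each safe interval at the entry lane. -/
def SIPPState.init {V ι : Type*} {K : ℕ} [Fintype ι] (I : Intersection V ι K)
    (H : ι → Option Profile) (i : ι) : SIPPState :=
  .search (((I.safeIntervals H i 0).map (fun J => (⟨0, fun _ => J⟩ : SIPPNode)) :
    List SIPPNode) : Multiset SIPPNode) none

/-- The steps of Level 2 for agent `i`, where `H` holds the trajectories of the agents of higher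
priority. -/
inductive SIPPStep {V ι : Type*} {K : ℕ} [Fintype ι] (I : Intersection V ι K) (n : ℕ) (ε Δ : ℝ)
    (H : ι → Option Profile) (i : ι) : SIPPState → SIPPState → Prop
  | finish (opn : Multiset SIPPNode) (best : Option Profile) :
      (∀ N ∈ opn, ¬ Improves best (I.fValue i N)) →
      SIPPStep I n ε Δ H i (.search opn best) (.done best)
  | expand (opn : Multiset SIPPNode) (best : Option Profile) (N : SIPPNode) :
      (∀ N' ∈ opn, I.fValue i N ≤ I.fValue i N') → Improves best (I.fValue i N) →
      N.depth < I.len i →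
      SIPPStep I n ε Δ H i (.search (N ::ₘ opn) best) (.search (opn + I.expand H i N) best)
  | call (opn : Multiset SIPPNode) (best : Option Profile) (N : SIPPNode) :
      (∀ N' ∈ opn, I.fValue i N ≤ I.fValue i N') → Improves best (I.fValue i N) →
      N.depth = I.len i →
      SIPPStep I n ε Δ H i (.search (N ::ₘ opn) best) (.level3 opn best N .start)
  | inner (opn : Multiset SIPPNode) (best : Option Profile) (N : SIPPNode) (b b' : BCPState) :
      BCPStep I n ε Δ i N.ivl b b' →
      SIPPStep I n ε Δ H i (.level3 opn best N b) (.level3 opn best N b')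
  | ret (opn : Multiset SIPPNode) (best : Option Profile) (N : SIPPNode) (r : Option Profile) :
      SIPPStep I n ε Δ H i (.level3 opn best N (.done r)) (.search opn (keepBest best r))

/-! ### Level 1: priority-based search -/

/-- A node of the priority tree: priority orderings (`order i j` means that `i` has higher
priority than `j`) and trajectories. -/
structure PTNode (ι : Type*) where
  order : ι → ι → Prop
  traj : ι → Profile

/-- The orderings `o` together with the ordering of `i` before `j`. -/
def addOrder {ι : Type*} (o : ι → ι → Prop) (i j : ι) : ι → ι → Prop :=
  fun a b => o a b ∨ (a = i ∧ b = j)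

/-- The known trajectories of the agents that have higher priority than `i`, directly or through
other agents. -/
def higher {ι : Type*} (o : ι → ι → Prop) (plan : ι → Option Profile) (i : ι) :
    ι → Option Profile :=
  open Classical in fun j => if Relation.TransGen o j i then plan j else none

/-- States of PSB. The depth-first search keeps a stack of nodes. In `siblings`, `ready` are the
new nodes already generated and `todo` the orderings for which a node is still to be generated; in
`plan` and `level2` the node with the orderings `o` is being generated. -/
inductive State (ι : Type*) where
  | search (stack : List (PTNode ι))
  | siblings (stack ready : List (PTNode ι)) (todo : List (ι → ι → Prop))
  | plan (stack ready : List (PTNode ι)) (todo : List (ι → ι → Prop))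
      (o : ι → ι → Prop) (pl : ι → Option Profile)
  | level2 (stack ready : List (PTNode ι)) (todo : List (ι → ι → Prop))
      (o : ι → ι → Prop) (pl : ι → Option Profile) (i : ι) (s : SIPPState)
  | solved (traj : ι → Profile)
  | failed

/-- Initially the root node is to be generated: agents from the same entry lane are ordered by
their earliest start times. -/
def State.init {V ι : Type*} {K : ℕ} (I : Intersection V ι K) : State ι :=
  .siblings [] [] [I.Ahead]

open Classical in
/-- The steps of PSB. -/
inductive Step {V ι : Type*} {K : ℕ} [Fintype ι] (I : Intersection V ι K) (n : ℕ) (ε Δ : ℝ) :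
    State ι → State ι → Prop
  | fail : Step I n ε Δ (.search []) .failed
  | success (N : PTNode ι) (stack : List (PTNode ι)) : (∀ i j, ¬ I.Collide N.traj i j) →
      Step I n ε Δ (.search (N :: stack)) (.solved N.traj)
  | branch (N : PTNode ι) (stack : List (PTNode ι)) (i j : ι) : I.Collide N.traj i j →
      Step I n ε Δ (.search (N :: stack))
        (.siblings stack [] [addOrder N.order i j, addOrder N.order j i])
  | push (stack ready l : List (PTNode ι)) : l.Perm ready →
      Step I n ε Δ (.siblings stack ready []) (.search (l ++ stack))
  | generate (stack ready : List (PTNode ι)) (o : ι → ι → Prop) (todo : List (ι → ι → Prop)) :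
      (∀ i, ¬ Relation.TransGen o i i) →
      Step I n ε Δ (.siblings stack ready (o :: todo)) (.plan stack ready todo o (fun _ => none))
  | cyclic (stack ready : List (PTNode ι)) (o : ι → ι → Prop) (todo : List (ι → ι → Prop)) (i : ι) :
      Relation.TransGen o i i →
      Step I n ε Δ (.siblings stack ready (o :: todo)) (.siblings stack ready todo)
  | call (stack ready : List (PTNode ι)) (todo : List (ι → ι → Prop)) (o : ι → ι → Prop)
      (pl : ι → Option Profile) (i : ι) : pl i = none →
      (∀ j, Relation.TransGen o j i → pl j ≠ none) →
      Step I n ε Δ (.plan stack ready todo o pl)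
        (.level2 stack ready todo o pl i (SIPPState.init I (higher o pl i) i))
  | inner (stack ready : List (PTNode ι)) (todo : List (ι → ι → Prop)) (o : ι → ι → Prop)
      (pl : ι → Option Profile) (i : ι) (s s' : SIPPState) :
      SIPPStep I n ε Δ (higher o pl i) i s s' →
      Step I n ε Δ (.level2 stack ready todo o pl i s) (.level2 stack ready todo o pl i s')
  | planned (stack ready : List (PTNode ι)) (todo : List (ι → ι → Prop)) (o : ι → ι → Prop)
      (pl : ι → Option Profile) (i : ι) (P : Profile) :
      Step I n ε Δ (.level2 stack ready todo o pl i (.done (some P)))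
        (.plan stack ready todo o (Function.update pl i (some P)))
  | discard (stack ready : List (PTNode ι)) (todo : List (ι → ι → Prop)) (o : ι → ι → Prop)
      (pl : ι → Option Profile) (i : ι) :
      Step I n ε Δ (.level2 stack ready todo o pl i (.done none)) (.siblings stack ready todo)
  | generated (stack ready : List (PTNode ι)) (todo : List (ι → ι → Prop)) (o : ι → ι → Prop)
      (traj : ι → Profile) :
      Step I n ε Δ (.plan stack ready todo o (fun i => some (traj i)))
        (.siblings stack (⟨o, traj⟩ :: ready) todo)

end

end PSB

/-! Soundness comes from the safe intervals: a trajectory that reaches each collision point after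
the lower end of a safe interval and has left it by the upper end keeps clear of all agents of
higher priority. Since the control points of the derivatives bound the derivatives, the curves of
slack `0` are such trajectories.

Level 2 always finds a trajectory. The last safe interval at every collision point is unbounded,
so there is a node all of whose intervals are unbounded. On it only lower bounds are imposed, so
the slack does not increase with the arrival time, and it is `0` from some time on: an agent may
enter late and travel at minimum speed. This happens at least `L / lo > ε` before the initial
upper end of the search interval, so that the bisection meets an arrival time of slack `0` before
it stops.

In Level 1 a colliding pair is unordered, since an agent keeps clear of those of higher priority.
Hence neither child of a node is cyclic, so the search never runs out of nodes; and each child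
leaves fewer pairs unordered, so the search stops. -/

namespace PSB

/-! ### Bézier curves -/

theorem bezier_eq_sum_bernstein (n : ℕ) {D : ℝ} (hD : D ≠ 0) (p : ℕ → ℝ) (x : ℝ) :
    bezier n D p x =
      ∑ r ∈ Finset.range (n + 1), p r * (bernsteinPolynomial ℝ n r).eval (x / D) := by
  have h : (D - x) / D = 1 - x / D := by rw [sub_div, div_self hD]
  simp [bezier, bernsteinPolynomial, h]

theorem bezier_apply_zero (n : ℕ) {D : ℝ} (hD : D ≠ 0) (p : ℕ → ℝ) : bezier n D p 0 = p 0 := by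
  simp [bezier_eq_sum_bernstein n hD, bernsteinPolynomial.eval_at_0]

theorem bezier_apply_length (n : ℕ) {D : ℝ} (hD : D ≠ 0) (p : ℕ → ℝ) :
    bezier n D p D = p n := by
  simp [bezier_eq_sum_bernstein n hD, bernsteinPolynomial.eval_at_1, div_self hD]

theorem bezier_mem_of_convex {n : ℕ} {D : ℝ} {p : ℕ → ℝ} {s : Set ℝ} (hs : Convex ℝ s)
    (hp : ∀ r ≤ n, p r ∈ s) {x : ℝ} (hD : 0 < D) (hx : x ∈ Set.Icc 0 D) : bezier n D p x ∈ s := by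
  have hsum : ∑ r ∈ Finset.range (n + 1), (bernsteinPolynomial ℝ n r).eval (x / D) = 1 := by
    rw [← Polynomial.eval_finsetSum, bernsteinPolynomial.sum, Polynomial.eval_one]
  have h0 : 0 ≤ x / D := div_nonneg hx.1 hD.le
  have h1 : 0 ≤ 1 - x / D := sub_nonneg.2 ((div_le_one hD).2 hx.2)
  have hmem := hs.sum_mem (t := Finset.range (n + 1)) (z := p)
    (fun r _ => by simp only [bernsteinPolynomial, Polynomial.eval_mul, Polynomial.eval_pow,
                     Polynomial.eval_natCast, Polynomial.eval_sub, Polynomial.eval_one,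
                     Polynomial.eval_X]; positivity)
    hsum fun r hr => hp r (Finset.mem_range_succ_iff.1 hr)
  simpa only [bezier_eq_sum_bernstein n hD.ne', smul_eq_mul, mul_comm] using hmem

theorem sum_mul_eval_derivative_bernstein (n : ℕ) (p : ℕ → ℝ) (y : ℝ) :
    ∑ r ∈ Finset.range (n + 1 + 1), p r * (bernsteinPolynomial ℝ (n + 1) r).derivative.eval y =
      (n + 1) * ∑ r ∈ Finset.range (n + 1),
        (p (r + 1) - p r) * (bernsteinPolynomial ℝ n r).eval y := by
  have hshift : ∑ r ∈ Finset.range (n + 1),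
        p (r + 1) * (bernsteinPolynomial ℝ n (r + 1)).eval y +
        p 0 * (bernsteinPolynomial ℝ n 0).eval y =
      ∑ r ∈ Finset.range (n + 1), p r * (bernsteinPolynomial ℝ n r).eval y := by
    rw [← Finset.sum_range_succ' (fun r => p r * (bernsteinPolynomial ℝ n r).eval y),
      Finset.sum_range_succ, bernsteinPolynomial.eq_zero_of_lt ℝ n.lt_succ_self,
      Polynomial.eval_zero, mul_zero, add_zero]
  have hsucc : ∀ r, p (r + 1) * (bernsteinPolynomial ℝ (n + 1) (r + 1)).derivative.eval y =
      (n + 1) * (p (r + 1) * (bernsteinPolynomial ℝ n r).eval y -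
        p (r + 1) * (bernsteinPolynomial ℝ n (r + 1)).eval y) := fun r => by
    simp [bernsteinPolynomial.derivative_succ]
    ring
  have hzero : (bernsteinPolynomial ℝ (n + 1) 0).derivative.eval y =
      -(n + 1) * (bernsteinPolynomial ℝ n 0).eval y := by
    simp [bernsteinPolynomial.derivative_zero]
  simp only [Finset.sum_range_succ' _ (n + 1), hsucc, hzero, ← Finset.mul_sum, sub_mul,
    Finset.sum_sub_distrib]
  linear_combination (-(n + 1 : ℝ)) * hshift

theorem hasDerivAt_bezier (n : ℕ) {D : ℝ} (hD : D ≠ 0) (p : ℕ → ℝ) (x : ℝ) :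
    HasDerivAt (bezier n D p) (bezier (n - 1) D (fun r => n / D * (p (r + 1) - p r)) x) x := by
  rcases n with _ | m
  · have hconst : bezier 0 D p = fun _ => p 0 := by ext; simp [bezier]
    rw [hconst]
    simpa [bezier] using hasDerivAt_const x (p 0)
  · rw [funext (bezier_eq_sum_bernstein (m + 1) hD p)]
    have h := HasDerivAt.fun_sum (u := Finset.range (m + 1 + 1)) fun r _ =>
      (((bernsteinPolynomial ℝ (m + 1) r).hasDerivAt (x / D)).comp x
        ((hasDerivAt_id x).div_const D)).const_mul (p r)
    refine h.congr_deriv ?_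
    simp only [← mul_assoc, ← Finset.sum_mul]
    rw [sum_mul_eval_derivative_bernstein, Nat.add_sub_cancel, bezier_eq_sum_bernstein m hD,
      Finset.mul_sum, Finset.sum_mul]
    refine Finset.sum_congr rfl fun r _ => ?_
    push_cast
    ring

theorem ctrl_eq_fwdDiff_iter (n : ℕ) (D : ℝ) (p : ℕ → ℝ) (k r : ℕ) :
    ctrl n D p k r = n.descFactorial k / D ^ k * (fwdDiff 1)^[k] p r := by
  rw [ctrl, fwdDiff_iter_eq_sum_shift, ← Finset.sum_range_reflect]
  congr 1
  refine Finset.sum_congr rfl fun j hj => ?_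
  have hj : j ≤ k := Finset.mem_range_succ_iff.1 hj
  have hsub : k + 1 - 1 - j = k - j := by omega
  have hidx : r + k - (k - j) = r + j := by omega
  rw [hsub, hidx, Nat.choose_symm hj]
  simp

theorem ctrl_zero (n : ℕ) (D : ℝ) (p : ℕ → ℝ) : ctrl n D p 0 = p := by
  ext r
  simp [ctrl_eq_fwdDiff_iter]

theorem ctrl_succ (n : ℕ) (D : ℝ) (p : ℕ → ℝ) (k r : ℕ) :
    ctrl n D p (k + 1) r = ((n - k : ℕ) : ℝ) / D * (ctrl n D p k (r + 1) - ctrl n D p k r) := by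
  simp only [ctrl_eq_fwdDiff_iter, Function.iterate_succ_apply', Nat.descFactorial_succ, fwdDiff,
    Nat.cast_mul, pow_succ]
  ring

theorem ctrl_of_lt {n k : ℕ} (h : n < k) (D : ℝ) (p : ℕ → ℝ) (r : ℕ) : ctrl n D p k r = 0 := by
  simp [ctrl, Nat.descFactorial_eq_zero_iff_lt.2 h]

theorem deriv_bezier_ctrl (n k : ℕ) {D : ℝ} (hD : D ≠ 0) (p : ℕ → ℝ) :
    deriv (bezier (n - k) D (ctrl n D p k)) = bezier (n - (k + 1)) D (ctrl n D p (k + 1)) := by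
  ext x
  rw [(hasDerivAt_bezier (n - k) hD (ctrl n D p k) x).deriv, Nat.sub_sub,
    funext fun r => ctrl_succ n D p k r]

theorem iteratedDeriv_bezier (n k : ℕ) {D : ℝ} (hD : D ≠ 0) (p : ℕ → ℝ) :
    iteratedDeriv k (bezier n D p) = bezier (n - k) D (ctrl n D p k) := by
  induction k with
  | zero => simp [ctrl_zero]
  | succ k ih => rw [iteratedDeriv_succ, ih, deriv_bezier_ctrl n k hD]

theorem contDiff_bezier (n : ℕ) (D : ℝ) (p : ℕ → ℝ) {N : WithTop ℕ∞} :
    ContDiff ℝ N (bezier n D p) := by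
  unfold bezier
  fun_prop

theorem monotoneOn_bezier {n : ℕ} {D : ℝ} (hD : 0 < D) {p : ℕ → ℝ}
    (hp : ∀ r < n, p r ≤ p (r + 1)) : MonotoneOn (bezier n D p) (Set.Icc 0 D) := by
  rcases n with _ | m
  · intro x _ y _ _
    simp [bezier]
  refine monotoneOn_of_hasDerivWithinAt_nonneg (convex_Icc 0 D)
    (contDiff_bezier _ D p (N := 0)).continuous.continuousOn
    (fun x _ => (hasDerivAt_bezier _ hD.ne' p x).hasDerivWithinAt) fun x hx => ?_
  refine bezier_mem_of_convex (convex_Ici 0) (fun r hr => ?_) hD (interior_subset hx)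
  exact mul_nonneg (by positivity) (sub_nonneg.2 (hp r (Nat.lt_succ_of_le hr)))

/-- The control points of the Bézier curve of degree `n` that covers the distance `d` at constant
speed. -/
noncomputable def linearCtrl (n : ℕ) (d : ℝ) (r : ℕ) : ℝ := d * r / n

theorem linearCtrl_self {n : ℕ} (hn : n ≠ 0) (d : ℝ) : linearCtrl n d n = d := by
  rw [linearCtrl, mul_div_cancel_right₀ _ (Nat.cast_ne_zero.2 hn)]

theorem linearCtrl_mono (n : ℕ) {d : ℝ} (hd : 0 ≤ d) : Monotone (linearCtrl n d) := by
  intro a b hab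
  unfold linearCtrl
  gcongr

theorem bezier_linearCtrl {n : ℕ} (hn : n ≠ 0) (d : ℝ) {D : ℝ} (hD : D ≠ 0) (x : ℝ) :
    bezier n D (linearCtrl n d) x = d / D * x := by
  have hmean := congrArg (Polynomial.eval (x / D)) (bernsteinPolynomial.sum_smul ℝ n)
  simp only [Polynomial.eval_finsetSum, nsmul_eq_mul, Polynomial.eval_mul,
    Polynomial.eval_natCast, Polynomial.eval_X] at hmean
  calc bezier n D (linearCtrl n d) x
      = d / n * ∑ r ∈ Finset.range (n + 1), r * (bernsteinPolynomial ℝ n r).eval (x / D) := by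
        rw [bezier_eq_sum_bernstein n hD, Finset.mul_sum]
        exact Finset.sum_congr rfl fun r _ => by rw [linearCtrl]; ring
    _ = d / D * x := by
        rw [hmean]
        field_simp

theorem ctrl_one_linearCtrl {n : ℕ} (hn : n ≠ 0) (d D : ℝ) (r : ℕ) :
    ctrl n D (linearCtrl n d) 1 r = d / D := by
  rw [ctrl_succ, ctrl_zero, linearCtrl, linearCtrl, Nat.sub_zero]
  push_cast
  field_simp
  ring

theorem ctrl_linearCtrl_of_two_le {n : ℕ} (hn : n ≠ 0) (d D : ℝ) {k : ℕ} (hk : 2 ≤ k) (r : ℕ) :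
    ctrl n D (linearCtrl n d) k r = 0 := by
  induction k, hk using Nat.le_induction generalizing r with
  | base => rw [ctrl_succ, ctrl_one_linearCtrl hn, ctrl_one_linearCtrl hn, sub_self, mul_zero]
  | succ k _ ih => rw [ctrl_succ, ih, ih, sub_self, mul_zero]

/-! ### Positions along a profile -/

namespace Profile

variable {P : Profile}

theorem eqOn_pos_dist (P : Profile) : Set.EqOn P.pos P.dist (Set.Icc P.start P.arrival) :=
  fun t ht => by rw [pos, if_neg ht.1.not_gt, if_pos ht.2]

theorem pos_of_arrival_le (h : P.start ≤ P.arrival) {t : ℝ} (ht : P.arrival ≤ t) :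
    P.pos t = P.dist P.arrival +
      derivWithin P.dist (Set.Icc P.start P.arrival) P.arrival * (t - P.arrival) := by
  rcases ht.eq_or_lt with rfl | hlt
  · rw [eqOn_pos_dist P (Set.right_mem_Icc.2 h), sub_self, mul_zero, add_zero]
  · rw [pos, if_neg (h.trans ht).not_gt, if_neg hlt.not_ge]

theorem strictMonoOn_pos (h : P.start ≤ P.arrival) (hpos : ∀ t ∈ Set.Icc P.start P.arrival,
    0 < derivWithin P.dist (Set.Icc P.start P.arrival) t) :
    StrictMonoOn P.pos (Set.Ici P.start) := by
  have hderiv : ∀ t ∈ Set.Icc P.start P.arrival, HasDerivWithinAt P.dist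
      (derivWithin P.dist (Set.Icc P.start P.arrival) t) (Set.Icc P.start P.arrival) t :=
    fun t ht => (differentiableWithinAt_of_derivWithin_ne_zero (hpos t ht).ne').hasDerivWithinAt
  have hdist : StrictMonoOn P.dist (Set.Icc P.start P.arrival) :=
    strictMonoOn_of_hasDerivWithinAt_pos (convex_Icc _ _)
      (fun t ht => (hderiv t ht).continuousWithinAt)
      (fun t ht => (hderiv t (interior_subset ht)).mono interior_subset)
      fun t ht => hpos t (interior_subset ht)
  have hafter : StrictMonoOn P.pos (Set.Ici P.arrival) := by
    intro x hx y hy hxy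
    rw [pos_of_arrival_le h hx, pos_of_arrival_le h hy]
    have := hpos _ (Set.right_mem_Icc.2 h)
    gcongr
  rw [← Set.Icc_union_Ici_eq_Ici h]
  exact (hdist.congr P.eqOn_pos_dist.symm).union hafter (isGreatest_Icc h) isLeast_Ici

theorem monotone_pos (h : P.start ≤ P.arrival) (h0 : P.dist P.start = 0)
    (hdist : MonotoneOn P.dist (Set.Icc P.start P.arrival)) : Monotone P.pos := by
  have hbefore : MonotoneOn P.pos (Set.Iic P.start) := by
    refine monotoneOn_const.congr (f₁ := fun _ => (0 : ℝ)) fun t (ht : t ≤ P.start) => ?_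
    rcases ht.eq_or_lt with rfl | hlt
    · rw [P.eqOn_pos_dist (Set.left_mem_Icc.2 h), h0]
    · rw [pos, if_pos hlt]
  have hafter : MonotoneOn P.pos (Set.Ici P.arrival) := by
    intro x hx y hy hxy
    rw [pos_of_arrival_le h hx, pos_of_arrival_le h hy]
    have := hdist.derivWithin_nonneg (x := P.arrival)
    gcongr
  refine hbefore.Iic_union_Ici ?_
  rw [← Set.Icc_union_Ici_eq_Ici h]
  exact (hdist.congr P.eqOn_pos_dist.symm).union_right hafter (isGreatest_Icc h) isLeast_Ici

end Profile

theorem iteratedDerivWithin_dist_bezierProfile (n k : ℕ) (p : ℕ → ℝ) {s T : ℝ} (hsT : s < T)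
    {t : ℝ} (ht : t ∈ Set.Icc s T) :
    iteratedDerivWithin k (bezierProfile n p s T).dist (Set.Icc s T) t =
      bezier (n - k) (T - s) (ctrl n (T - s) p k) (t - s) := by
  have hsmooth : ContDiff ℝ k (bezierProfile n p s T).dist :=
    (contDiff_bezier n (T - s) p).comp (contDiff_id.sub contDiff_const)
  rw [iteratedDerivWithin_eq_iteratedDeriv (uniqueDiffOn_Icc hsT) hsmooth.contDiffAt ht,
    ← iteratedDeriv_bezier n k (sub_ne_zero.2 hsT.ne')]
  exact congrFun (iteratedDeriv_comp_sub_const k (bezier n (T - s) p) s) t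

theorem pos_bezierProfile (n : ℕ) (p : ℕ → ℝ) {s T : ℝ} (hsT : s < T) (t : ℝ) :
    (bezierProfile n p s T).pos t =
      if t < s then 0
      else if t ≤ T then bezier n (T - s) p (t - s)
      else p n + ctrl n (T - s) p 1 (n - 1) * (t - T) := by
  have hD : T - s ≠ 0 := sub_ne_zero.2 hsT.ne'
  have hgoal : (bezierProfile n p s T).dist T = p n := bezier_apply_length n hD p
  have hspeed : derivWithin (bezierProfile n p s T).dist (Set.Icc s T) T =
      ctrl n (T - s) p 1 (n - 1) := by
    rw [← iteratedDerivWithin_one,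
      iteratedDerivWithin_dist_bezierProfile n 1 p hsT (Set.right_mem_Icc.2 hsT.le),
      bezier_apply_length _ hD]
  rw [← hgoal, ← hspeed]
  rfl

theorem pos_bezierProfile_add (n : ℕ) (p : ℕ → ℝ) {s T : ℝ} (hsT : s < T) (h t : ℝ) :
    (bezierProfile n p (s + h) (T + h)).pos t = (bezierProfile n p s T).pos (t - h) := by
  rw [pos_bezierProfile n p (by gcongr), pos_bezierProfile n p hsT, add_sub_add_right_eq_sub]
  simp only [sub_lt_iff_lt_add, sub_le_iff_le_add, sub_sub, add_comm]

theorem monotone_pos_bezierProfile {n : ℕ} {p : ℕ → ℝ} {s T : ℝ} (hsT : s < T) (h0 : p 0 = 0)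
    (hp : ∀ r < n, p r ≤ p (r + 1)) : Monotone (bezierProfile n p s T).pos := by
  have hD : 0 < T - s := sub_pos.2 hsT
  refine Profile.monotone_pos hsT.le ?_ fun x hx y hy hxy => ?_
  · simp only [bezierProfile, sub_self, bezier_apply_zero n hD.ne', h0]
  · exact monotoneOn_bezier hD hp ⟨sub_nonneg.2 hx.1, sub_le_sub_right hx.2 s⟩
      ⟨sub_nonneg.2 hy.1, sub_le_sub_right hy.2 s⟩ (sub_le_sub_right hxy s)

theorem pos_bezierProfile_linearCtrl {n : ℕ} (hn : n ≠ 0) {d : ℝ} (hd : 0 ≤ d) {s T : ℝ}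
    (hsT : s < T) (t : ℝ) :
    (bezierProfile n (linearCtrl n d) s T).pos t = max 0 (d / (T - s) * (t - s)) := by
  have hD : 0 < T - s := sub_pos.2 hsT
  rw [pos_bezierProfile n _ hsT, bezier_linearCtrl hn d hD.ne', linearCtrl_self hn,
    ctrl_one_linearCtrl hn]
  split_ifs with hts htT
  · rw [max_eq_left (mul_nonpos_of_nonneg_of_nonpos (by positivity) (by linarith))]
  · rw [max_eq_right (mul_nonneg (by positivity) (by linarith))]
  · rw [max_eq_right (mul_nonneg (by positivity) (by linarith))]
    field_simp
    ring

namespace Intersection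

variable {V ι : Type*} {K : ℕ} (I : Intersection V ι K)

theorem travel_nonneg {i : ι} {q : ℕ} (hq : q ≤ I.len i) : 0 ≤ I.travel i q :=
  Finset.sum_nonneg fun r hr =>
    (I.edgeDist_pos _ _ (I.path_adj i r ((Finset.mem_range.1 hr).trans_le hq))).le

theorem len_pos (i : ι) : 0 < I.len i := by
  refine Nat.pos_of_ne_zero fun h => ?_
  have hgoal := I.path_goal i
  rw [h] at hgoal
  exact Set.disjoint_left.1 I.lanes_disjoint (I.path_start i) hgoal

theorem total_pos (i : ι) : 0 < I.total i :=
  Finset.sum_pos (fun r hr => I.edgeDist_pos _ _ (I.path_adj i r (Finset.mem_range.1 hr)))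
    (Finset.nonempty_range_iff.2 (I.len_pos i).ne')

theorem bddBelow_passed (P : Profile) (d : ℝ) : BddBelow {t | P.start ≤ t ∧ d ≤ P.pos t} :=
  ⟨P.start, fun _ ht => ht.1⟩

namespace IsKinodynamic

variable {I} {i : ι} {P : Profile} (hP : I.IsKinodynamic i P)

include hP

theorem derivWithin_pos {t : ℝ} (ht : t ∈ Set.Icc P.start P.arrival) :
    0 < derivWithin P.dist (Set.Icc P.start P.arrival) t := by
  have hlo := (hP.bounds 1 le_rfl I.order_pos t ht).1
  rw [iteratedDerivWithin_one] at hlo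
  exact (I.minSpeed_pos i).trans_le hlo

theorem strictMonoOn_pos : StrictMonoOn P.pos (Set.Ici P.start) :=
  Profile.strictMonoOn_pos hP.start_lt.le fun _ ht => hP.derivWithin_pos ht

theorem exists_le_pos (d : ℝ) : ∃ t, P.start ≤ t ∧ d ≤ P.pos t := by
  have hv := hP.derivWithin_pos (Set.right_mem_Icc.2 hP.start_lt.le)
  have htendsto : Filter.Tendsto P.pos Filter.atTop Filter.atTop := by
    refine Filter.Tendsto.congr' (Filter.eventually_ge_atTop P.arrival |>.mono fun t ht =>
      (Profile.pos_of_arrival_le hP.start_lt.le ht).symm) ?_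
    exact Filter.tendsto_atTop_add_const_left _ _
      ((Filter.tendsto_id.atTop_add tendsto_const_nhds).const_mul_atTop hv)
  exact ((Filter.eventually_ge_atTop P.start).and (htendsto.eventually_ge_atTop d)).exists

theorem reach_lt_leave (q : ℕ) : I.reach i P q < I.leave i P q := by
  have hle : I.reach i P q ≤ sInf {t | P.start ≤ t ∧ I.travel i q + I.length i ≤ P.pos t} :=
    csInf_le_csInf (bddBelow_passed P _) (hP.exists_le_pos _) fun t ht =>
      ⟨ht.1, (lt_add_of_pos_right _ (I.length_pos i)).le.trans ht.2⟩
  exact hle.trans_lt (lt_add_of_pos_right _ (div_pos (I.length_pos i) I.waveSpeed_pos))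

theorem le_reach {q : ℕ} {b : ℝ} (h : P.pos b ≤ I.travel i q) : b ≤ I.reach i P q := by
  refine le_csInf (hP.exists_le_pos _) fun t ⟨hst, ht⟩ => ?_
  by_contra! hlt
  exact (hP.strictMonoOn_pos hst (hst.trans hlt.le) hlt).not_ge (h.trans ht)

end IsKinodynamic

theorem leave_le {i : ι} {P : Profile} {q : ℕ} (hq : q ≤ I.len i) {u : ℝ}
    (h : I.travel i q + I.length i ≤ P.pos (u - I.length i / I.waveSpeed)) :
    I.leave i P q ≤ u := by
  have hstart : P.start ≤ u - I.length i / I.waveSpeed := by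
    by_contra! hlt
    rw [Profile.pos, if_pos hlt] at h
    exact (add_pos_of_nonneg_of_pos (I.travel_nonneg hq) (I.length_pos i)).not_ge h
  exact le_sub_iff_add_le.1 (csInf_le (bddBelow_passed P _) ⟨hstart, h⟩)

end Intersection

/-! ### Level 3: zero slack and the search for the arrival time -/

/-- The first `m + 1` of the intervals `S` have no upper bound, so that an agent cannot be late. -/
def UnboundedUpTo (S : ℕ → TimeInterval) (m : ℕ) : Prop := ∀ j ≤ m, (S j).ub = ⊤

section Level3

variable {V ι : Type*} {K : ℕ} {I : Intersection V ι K} {n : ℕ} {ε Δ : ℝ} {i : ι}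
  {S : ℕ → TimeInterval}

namespace Intersection

namespace SlackFeasible

variable {T s δ : ℝ} {p : ℕ → ℝ}

theorem degree_ne_zero (h : I.SlackFeasible n i S T s p δ) : n ≠ 0 := by
  rintro rfl
  exact (I.total_pos i).ne (h.first.symm.trans h.last)

theorem ctrl_mem_Icc (h : I.SlackFeasible n i S T s p 0) {k : ℕ} (hk : 1 ≤ k) (hkK : k ≤ K) {r : ℕ}
    (hr : r ≤ n - k) : ctrl n (T - s) p k r ∈ Set.Icc (I.lo i k) (I.hi i k) := by
  rcases le_or_gt k n with hkn | hkn
  · simpa using h.bounds k hk hkK r (by omega)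
  · rw [ctrl_of_lt hkn]
    exact I.higher_bounds i k (by have := h.degree_ne_zero; omega) hkK

theorem iteratedDerivWithin_mem_Icc (h : I.SlackFeasible n i S T s p 0) {k : ℕ} (hk : 1 ≤ k)
    (hkK : k ≤ K) {t : ℝ} (ht : t ∈ Set.Icc s T) :
    iteratedDerivWithin k (bezierProfile n p s T).dist (Set.Icc s T) t ∈
      Set.Icc (I.lo i k) (I.hi i k) := by
  rw [iteratedDerivWithin_dist_bezierProfile n k p h.start_lt ht]
  exact bezier_mem_of_convex (convex_Icc _ _) (fun r hr => h.ctrl_mem_Icc hk hkK hr)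
    (sub_pos.2 h.start_lt) ⟨sub_nonneg.2 ht.1, sub_le_sub_right ht.2 s⟩

theorem dist_start (h : I.SlackFeasible n i S T s p δ) : (bezierProfile n p s T).dist s = 0 := by
  simp only [bezierProfile, sub_self, bezier_apply_zero n (sub_ne_zero.2 h.start_lt.ne'), h.first]

theorem lb_le_start (h : I.SlackFeasible n i S T s p 0) : (S 0).lb ≤ s := by
  by_contra! hlt
  have hmono : StrictMonoOn (bezierProfile n p s T).pos (Set.Ici s) := by
    refine Profile.strictMonoOn_pos h.start_lt.le fun t ht => ?_
    rw [← iteratedDerivWithin_one]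
    exact (I.minSpeed_pos i).trans_le (h.iteratedDerivWithin_mem_Icc le_rfl I.order_pos ht).1
  have hstart : (bezierProfile n p s T).pos s = 0 :=
    (Profile.eqOn_pos_dist _ (Set.left_mem_Icc.2 h.start_lt.le)).trans h.dist_start
  have hearly : (bezierProfile n p s T).pos (S 0).lb ≤ 0 := by
    simpa [travel] using h.not_early 0 (Nat.zero_le _)
  exact (hstart ▸ hmono Set.self_mem_Ici hlt.le hlt).not_ge hearly

theorem isKinodynamic (h : I.SlackFeasible n i S T s p 0) (hS : I.earliest i ≤ (S 0).lb) :
    I.IsKinodynamic i (bezierProfile n p s T) where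
  earliest_le := hS.trans h.lb_le_start
  start_lt := h.start_lt
  dist_start := h.dist_start
  dist_arrival := (bezier_apply_length n (sub_ne_zero.2 h.start_lt.ne') p).trans h.last
  contDiff := ((contDiff_bezier n (T - s) p).comp (contDiff_id.sub contDiff_const)).contDiffOn
  initial k hk hkK := by
    refine (iteratedDerivWithin_dist_bezierProfile n k p h.start_lt
      (Set.left_mem_Icc.2 h.start_lt.le)).trans ?_
    rw [sub_self, bezier_apply_zero _ (sub_ne_zero.2 h.start_lt.ne')]
    exact h.initial k hk hkK
  bounds _ hk hkK _ ht := h.iteratedDerivWithin_mem_Icc hk hkK ht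

theorem shift (h : I.SlackFeasible n i S T s p δ) (hS : UnboundedUpTo S (I.len i)) {t : ℝ}
    (ht : 0 ≤ t) : I.SlackFeasible n i S (T + t) (s + t) p δ where
  slack_nonneg := h.slack_nonneg
  start_lt := by gcongr; exact h.start_lt
  first := h.first
  last := h.last
  initial := by rw [add_sub_add_right_eq_sub]; exact h.initial
  monotone := h.monotone
  not_early j hj := by
    rw [pos_bezierProfile_add n p h.start_lt]
    exact (monotone_pos_bezierProfile h.start_lt h.first h.monotone (sub_le_self _ ht)).trans
      (h.not_early j hj)
  not_late j hj u hu := absurd ((hS j hj).symm.trans hu) WithTop.top_ne_coe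
  bounds := by rw [add_sub_add_right_eq_sub]; exact h.bounds

end SlackFeasible

namespace IsZeroSlack

variable {T : ℝ} {P : Profile}

theorem isKinodynamic (h : I.IsZeroSlack n i S T P) (hS : I.earliest i ≤ (S 0).lb) :
    I.IsKinodynamic i P := by
  obtain ⟨s, p, rfl, hf⟩ := h
  exact hf.isKinodynamic hS

theorem lb_le_reach (h : I.IsZeroSlack n i S T P) (hS : I.earliest i ≤ (S 0).lb) {q : ℕ}
    (hq : q ≤ I.len i) : (S q).lb ≤ I.reach i P q := by
  refine (h.isKinodynamic hS).le_reach ?_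
  obtain ⟨s, p, rfl, hf⟩ := h
  simpa using hf.not_early q hq

theorem leave_le_ub (h : I.IsZeroSlack n i S T P) {q : ℕ} (hq : q ≤ I.len i) :
    (I.leave i P q : WithTop ℝ) ≤ (S q).ub := by
  obtain ⟨s, p, rfl, hf⟩ := h
  rcases hu : (S q).ub with _ | u
  · exact le_top
  · refine WithTop.coe_le_coe.2 (I.leave_le hq ?_)
    simpa using (hf.not_late q hq u hu).le

end IsZeroSlack

theorem optSlack_nonneg (I : Intersection V ι K) (n : ℕ) (i : ι) (S : ℕ → TimeInterval) (T : ℝ) :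
    0 ≤ I.optSlack n i S T :=
  Real.sInf_nonneg fun _ ⟨_, _, hf⟩ => hf.slack_nonneg

theorem bddBelow_slack (I : Intersection V ι K) (n : ℕ) (i : ι) (S : ℕ → TimeInterval) (T : ℝ) :
    BddBelow {δ | ∃ s p, I.SlackFeasible n i S T s p δ} :=
  ⟨0, fun _ ⟨_, _, hf⟩ => hf.slack_nonneg⟩

theorem IsZeroSlack.optSlack_eq_zero {T : ℝ} {P : Profile} (h : I.IsZeroSlack n i S T P) :
    I.optSlack n i S T = 0 := by
  obtain ⟨s, p, -, hf⟩ := h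
  exact le_antisymm (csInf_le (I.bddBelow_slack n i S T) ⟨s, p, hf⟩) (I.optSlack_nonneg n i S T)

theorem ctrl_linearCtrl_total (hn : n ≠ 0) (i : ι) {k : ℕ} (hk : 1 ≤ k) (r : ℕ) :
    ctrl n (I.total i / I.lo i 1) (linearCtrl n (I.total i)) k r = I.initial i k := by
  rcases hk.eq_or_lt with rfl | hk
  · rw [ctrl_one_linearCtrl hn, div_div_cancel₀ (I.total_pos i).ne', initial, if_pos rfl]
  · rw [ctrl_linearCtrl_of_two_le hn _ _ hk, initial, if_neg hk.ne']

theorem initial_mem_Icc (I : Intersection V ι K) (i : ι) {k : ℕ} (hk : 1 ≤ k) (hkK : k ≤ K) :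
    I.initial i k ∈ Set.Icc (I.lo i k) (I.hi i k) := by
  rcases hk.eq_or_lt with rfl | hk
  · simpa [initial] using I.speed_le i
  · rw [initial, if_neg hk.ne']
    exact I.higher_bounds i k hk hkK

theorem slackFeasible_linearCtrl (hn : n ≠ 0) (hS : UnboundedUpTo S (I.len i)) (T : ℝ) {δ : ℝ}
    (hδ : 0 ≤ δ) (hearly : ∀ j ≤ I.len i,
      I.lo i 1 * ((S j).lb - (T - I.total i / I.lo i 1)) ≤ I.travel i j + δ) :
    I.SlackFeasible n i S T (T - I.total i / I.lo i 1) (linearCtrl n (I.total i)) δ where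
  slack_nonneg := hδ
  start_lt := sub_lt_self T (div_pos (I.total_pos i) (I.minSpeed_pos i))
  first := by simp [linearCtrl]
  last := linearCtrl_self hn _
  initial k hk _ := by rw [sub_sub_cancel, ctrl_linearCtrl_total hn i hk]
  monotone r _ := linearCtrl_mono n (I.total_pos i).le r.le_succ
  not_early j hj := by
    rw [pos_bezierProfile_linearCtrl hn (I.total_pos i).le
      (sub_lt_self T (div_pos (I.total_pos i) (I.minSpeed_pos i))), sub_sub_cancel,
      div_div_cancel₀ (I.total_pos i).ne']
    exact max_le (add_nonneg (I.travel_nonneg hj) hδ) (hearly j hj)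
  not_late j hj u hu := absurd ((hS j hj).symm.trans hu) WithTop.top_ne_coe
  bounds k hk hkK r _ := by
    rw [sub_sub_cancel, ctrl_linearCtrl_total hn i hk]
    have := I.initial_mem_Icc i hk hkK
    exact ⟨(sub_le_self _ hδ).trans this.1, this.2.trans (le_add_of_nonneg_right hδ)⟩

theorem exists_slackFeasible (hn : n ≠ 0) (hS : UnboundedUpTo S (I.len i)) (T : ℝ) :
    ∃ δ s p, I.SlackFeasible n i S T s p δ := by
  obtain ⟨δ, hδ⟩ := ((Set.finite_Iic (I.len i)).image fun j =>
    I.lo i 1 * ((S j).lb - (T - I.total i / I.lo i 1)) - I.travel i j).bddAbove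
  refine ⟨max 0 δ, _, _, slackFeasible_linearCtrl hn hS T (le_max_left _ _) fun j hj => ?_⟩
  rw [← sub_le_iff_le_add']
  exact (hδ (Set.mem_image_of_mem _ hj)).trans (le_max_right _ _)

theorem gradSlack_nonpos (hn : n ≠ 0) (hS : UnboundedUpTo S (I.len i)) (hΔ : 0 ≤ Δ) (T : ℝ) :
    I.gradSlack n Δ i S T ≤ 0 := by
  have hanti : I.optSlack n i S (T + Δ) ≤ I.optSlack n i S T :=
    csInf_le_csInf (I.bddBelow_slack n i S _) (exists_slackFeasible hn hS T)
      fun _ ⟨_, _, hf⟩ => ⟨_, _, hf.shift hS hΔ⟩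
  exact div_nonpos_of_nonpos_of_nonneg (sub_nonpos.2 hanti) hΔ

theorem gradSlack_nonneg_of_isZeroSlack {T : ℝ} {P : Profile} (h : I.IsZeroSlack n i S T P)
    (hΔ : 0 ≤ Δ) : 0 ≤ I.gradSlack n Δ i S T := by
  rw [gradSlack, h.optSlack_eq_zero, sub_zero]
  exact div_nonneg (I.optSlack_nonneg n i S _) hΔ

theorem lb_add_le_upperBound (htop : (S (I.len i)).ub = ⊤) {j : ℕ} (hj : j ≤ I.len i) :
    (S j).lb + (I.total i - I.travel i j) / I.lo i 1 ≤
      I.upperBound i S - I.length i / I.lo i 1 := by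
  have hsup := Finset.le_sup' (fun j => (S j).lb - I.travel i j / I.lo i 1)
    (Finset.mem_range_succ_iff.2 hj)
  have hub : I.upperBound i S = (Finset.range (I.len i + 1)).sup' Finset.nonempty_range_add_one
      (fun j => (S j).lb - I.travel i j / I.lo i 1) + (I.total i + I.length i) / I.lo i 1 := by
    unfold upperBound
    rw [htop]
  rw [hub, add_div, sub_div]
  linarith

theorem exists_isZeroSlack (hn : n ≠ 0) (hS : UnboundedUpTo S (I.len i)) {T : ℝ}
    (hT : I.upperBound i S - I.length i / I.lo i 1 ≤ T) : ∃ P, I.IsZeroSlack n i S T P := by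
  refine ⟨_, _, _, rfl, slackFeasible_linearCtrl hn hS T le_rfl fun j hj => ?_⟩
  have hub := (lb_add_le_upperBound (hS _ le_rfl) hj).trans hT
  rw [sub_div] at hub
  rw [add_zero, mul_comm, ← le_div_iff₀ (I.minSpeed_pos i)]
  linarith

end Intersection

/-- The profile held by a state of Level 3, if any, has slack zero. -/
def BCPState.Sound (I : Intersection V ι K) (n : ℕ) (i : ι) (S : ℕ → TimeInterval) :
    BCPState → Prop
  | start => True
  | search _ _ best => ∀ P ∈ best, ∃ T, I.IsZeroSlack n i S T P
  | done r => ∀ P ∈ r, ∃ T, I.IsZeroSlack n i S T P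

theorem BCPStep.sound {b b' : BCPState} (h : BCPStep I n ε Δ i S b b') (hb : b.Sound I n i S) :
    b'.Sound I n i S := by
  cases h with
  | init | noSolution => exact fun P hP => nomatch hP
  | feasible _ _ _ P _ hP =>
    rintro _ ⟨⟩
    exact ⟨_, hP⟩
  | left | right | halt => exact hb

/-- Invariant of Level 3 on unbounded intervals: as long as no profile has been found, the upper
bound of the search is the initial one, and the search goes on; it cannot end without a profile. -/
def BCPState.Live (I : Intersection V ι K) (ε : ℝ) (i : ι) (S : ℕ → TimeInterval) :
    BCPState → Prop
  | start => True
  | search Tlb Tub best => best = none → Tub = I.upperBound i S ∧ ε < Tub - Tlb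
  | done r => r ≠ none

theorem BCPStep.live (hn : n ≠ 0) (hε : 0 < ε) (hεL : ε < I.length i / I.lo i 1) (hΔ : 0 ≤ Δ)
    (hS : UnboundedUpTo S (I.len i)) {b b' : BCPState} (h : BCPStep I n ε Δ i S b b')
    (hb : b.Live I ε i S) : b'.Live I ε i S := by
  have hgrad := Intersection.gradSlack_nonpos hn hS hΔ
  cases h with
  | init =>
    refine fun _ => ⟨rfl, ?_⟩
    have hub := Intersection.lb_add_le_upperBound (hS _ le_rfl) le_rfl
    rw [← Intersection.total, sub_self, zero_div] at hub
    linarith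
  | noSolution hno =>
    obtain ⟨P, hP⟩ := Intersection.exists_isZeroSlack hn hS (T := I.upperBound i S)
      (sub_le_self _ (hε.trans hεL).le)
    exact absurd ⟨hgrad _, Intersection.gradSlack_nonneg_of_isZeroSlack hP hΔ⟩ hno
  | feasible => exact fun hnone => nomatch hnone
  | left _ _ _ _ _ hpos => exact absurd hpos (hgrad _).not_gt
  | right Tlb Tub best _ hno =>
    intro hbest
    refine ⟨(hb hbest).1, ?_⟩
    -- From `upperBound - L / lo` on every arrival time is feasible, and `ε < L / lo`.
    by_contra! hle
    refine hno (Intersection.exists_isZeroSlack hn hS ?_)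
    rw [← (hb hbest).1]
    linarith
  | halt _ _ _ hle => exact fun hnone => (hb hnone).2.not_ge hle

theorem BCPState.exists_step (b : BCPState) :
    (∃ r, b = .done r) ∨ ∃ b', BCPStep I n ε Δ i S b b' := by
  rcases b with _ | ⟨Tlb, Tub, best⟩ | r
  · right
    by_cases h : I.gradSlack n Δ i S (S (I.len i)).lb ≤ 0 ∧
      0 ≤ I.gradSlack n Δ i S (I.upperBound i S)
    exacts [⟨_, .init h.1 h.2⟩, ⟨_, .noSolution h⟩]
  · right
    rcases le_or_gt (Tub - Tlb) ε with hle | hlt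
    · exact ⟨_, .halt _ _ _ hle⟩
    by_cases hP : ∃ P, I.IsZeroSlack n i S ((Tlb + Tub) / 2) P
    · obtain ⟨P, hP⟩ := hP
      exact ⟨_, .feasible _ _ _ P hlt hP⟩
    rcases lt_or_ge 0 (I.gradSlack n Δ i S ((Tlb + Tub) / 2)) with hpos | hle
    exacts [⟨_, .left _ _ _ hlt hP hpos⟩, ⟨_, .right _ _ _ hlt hP hle⟩]
  · exact Or.inl ⟨r, rfl⟩

theorem BCPState.acc_done (r : Option Profile) : Acc (flip (BCPStep I n ε Δ i S)) (.done r) :=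
  ⟨_, fun _ h => nomatch h⟩

theorem BCPState.acc_search (hε : 0 < ε) (Tlb Tub : ℝ) (best : Option Profile) :
    Acc (flip (BCPStep I n ε Δ i S)) (.search Tlb Tub best) := by
  obtain ⟨m, hm⟩ : ∃ m : ℕ, Tub - Tlb ≤ ε * 2 ^ m := by
    obtain ⟨m, hm⟩ := pow_unbounded_of_one_lt ((Tub - Tlb) / ε) (one_lt_two (α := ℝ))
    exact ⟨m, ((div_lt_iff₀' hε).1 hm).le⟩
  induction m generalizing Tlb Tub best with
  | zero =>
    rw [pow_zero, mul_one] at hm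
    refine ⟨_, fun b' h => ?_⟩
    cases h with
    | halt => exact acc_done _
    | feasible _ _ _ _ hlt | left _ _ _ hlt | right _ _ _ hlt => exact absurd hlt hm.not_gt
  | succ m ih =>
    rw [pow_succ] at hm
    refine ⟨_, fun b' h => ?_⟩
    cases h with
    | halt => exact acc_done _
    | feasible | left | right => exact ih _ _ _ (by linarith)

theorem BCPState.acc (hε : 0 < ε) : ∀ b : BCPState, Acc (flip (BCPStep I n ε Δ i S)) b
  | start => ⟨_, fun b' h => by
      cases h with
      | init => exact acc_search hε _ _ _
      | noSolution => exact acc_done _⟩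
  | search Tlb Tub best => acc_search hε Tlb Tub best
  | done r => acc_done r

end Level3

/-! ### Level 2: safe intervals and the search for a path through them -/

section Level2

namespace TimeInterval

variable {J J' J'' : TimeInterval} {b : ℝ × ℝ}

/-- The interval `J` lies within the interval `J'`, in terms of the end points. -/
def Within (J J' : TimeInterval) : Prop := J'.lb ≤ J.lb ∧ J.ub ≤ J'.ub

/-- The interval `J` ends before the blocked time `[b.1, b.2)` or begins after it. -/
def Avoids (J : TimeInterval) (b : ℝ × ℝ) : Prop := J.ub ≤ (b.1 : WithTop ℝ) ∨ b.2 ≤ J.lb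

theorem Within.refl (J : TimeInterval) : J.Within J := ⟨le_rfl, le_rfl⟩

theorem Within.trans (h : J.Within J') (h' : J'.Within J'') : J.Within J'' :=
  ⟨h'.1.trans h.1, h.2.trans h'.2⟩

theorem Avoids.mono (h : J'.Avoids b) (hw : J.Within J') : J.Avoids b :=
  h.imp hw.2.trans fun hb => hb.trans hw.1

theorem of_mem_remove (h : J' ∈ J.remove b) :
    J'.Within J ∧ (J'.lb : WithTop ℝ) < J'.ub ∧ J'.Avoids b := by
  simp only [remove, List.mem_filter, List.mem_cons, List.not_mem_nil, or_false,
    decide_eq_true_eq] at h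
  obtain ⟨rfl | rfl, hlt⟩ := h
  · exact ⟨⟨le_rfl, min_le_left _ _⟩, hlt, Or.inl (min_le_right _ _)⟩
  · exact ⟨⟨le_max_left _ _, le_rfl⟩, hlt, Or.inr (le_max_right _ _)⟩

theorem exists_top_mem_remove (h : J.ub = ⊤) (b : ℝ × ℝ) : ∃ J' ∈ J.remove b, J'.ub = ⊤ := by
  refine ⟨⟨max J.lb b.2, J.ub⟩, ?_, h⟩
  simp [remove, h]

theorem of_mem_foldl_remove {bs : List (ℝ × ℝ)} {Js : List TimeInterval}
    (hJs : ∀ J ∈ Js, (J.lb : WithTop ℝ) < J.ub)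
    (hJ : J ∈ bs.foldl (fun Js b => Js.flatMap (fun J => J.remove b)) Js) :
    (∃ J' ∈ Js, J.Within J') ∧ (J.lb : WithTop ℝ) < J.ub ∧ ∀ b ∈ bs, J.Avoids b := by
  induction bs generalizing Js with
  | nil => exact ⟨⟨J, hJ, .refl J⟩, hJs J hJ, by simp⟩
  | cons b bs ih =>
    obtain ⟨⟨J₁, hJ₁, hw₁⟩, hlt, havoid⟩ := ih (fun J₁ hJ₁ => by
      obtain ⟨J₀, -, hmem⟩ := List.mem_flatMap.1 hJ₁
      exact (of_mem_remove hmem).2.1) hJ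
    obtain ⟨J₀, hJ₀, hmem⟩ := List.mem_flatMap.1 hJ₁
    obtain ⟨hw₀, -, havoid₁⟩ := of_mem_remove hmem
    exact ⟨⟨J₀, hJ₀, hw₁.trans hw₀⟩, hlt, List.forall_mem_cons.2 ⟨havoid₁.mono hw₁, havoid⟩⟩

theorem exists_top_mem_foldl_remove (bs : List (ℝ × ℝ)) {Js : List TimeInterval}
    (hJs : ∃ J ∈ Js, J.ub = ⊤) :
    ∃ J ∈ bs.foldl (fun Js b => Js.flatMap (fun J => J.remove b)) Js, J.ub = ⊤ := by
  induction bs generalizing Js with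
  | nil => exact hJs
  | cons b bs ih =>
    obtain ⟨J, hJ, htop⟩ := hJs
    obtain ⟨J', hJ', htop'⟩ := exists_top_mem_remove htop b
    exact ih ⟨J', List.mem_flatMap.2 ⟨J, hJ, hJ'⟩, htop'⟩

end TimeInterval

variable {V ι : Type*} {K : ℕ} {I : Intersection V ι K} [Fintype ι] {n : ℕ} {ε Δ : ℝ} {i : ι}
  {H : ι → Option Profile} {N N' : SIPPNode}

namespace Intersection

section SafeIntervals

variable {q : ℕ} {J : TimeInterval}

theorem of_mem_safeIntervals (hJ : J ∈ I.safeIntervals H i q) :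
    I.earliest i ≤ J.lb ∧ (J.lb : WithTop ℝ) < J.ub ∧ ∀ b ∈ I.blocks H i q, J.Avoids b := by
  obtain ⟨⟨J', hJ', hw⟩, hlt, havoid⟩ := TimeInterval.of_mem_foldl_remove
    (by simp only [List.mem_singleton, forall_eq]; exact WithTop.coe_lt_top _) hJ
  obtain rfl := List.mem_singleton.1 hJ'
  exact ⟨hw.1, hlt, havoid⟩

theorem exists_top_mem_safeIntervals (I : Intersection V ι K) (H : ι → Option Profile) (i : ι)
    (q : ℕ) : ∃ J ∈ I.safeIntervals H i q, J.ub = ⊤ :=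
  TimeInterval.exists_top_mem_foldl_remove _ ⟨_, List.mem_singleton_self _, rfl⟩

variable {j : ι} {Q : Profile} {r : ℕ}

open Classical in
theorem mem_blocks (hQ : H j = some Q) (hr : r ≤ I.len j) (hpath : I.path j r = I.path i q) :
    (if I.Ahead j i then min (I.earliest i) (I.reach j Q r) else I.reach j Q r, I.leave j Q r) ∈
      I.blocks H i q := by
  refine List.mem_flatMap.2 ⟨j, Finset.mem_toList.2 (Finset.mem_univ _), ?_⟩
  rw [hQ]
  refine List.mem_map.2 ⟨r, List.mem_filter.2 ⟨List.mem_range.2 (Nat.lt_succ_of_le hr), ?_⟩, rfl⟩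
  exact decide_eq_true hpath

theorem avoids_of_mem_safeIntervals (hJ : J ∈ I.safeIntervals H i q) (hQ : H j = some Q)
    (hr : r ≤ I.len j) (hpath : I.path j r = I.path i q) :
    J.Avoids (I.reach j Q r, I.leave j Q r) := by
  refine ((of_mem_safeIntervals hJ).2.2 _ (mem_blocks hQ hr hpath)).imp_left fun hub =>
    hub.trans (WithTop.coe_le_coe.2 ?_)
  dsimp only
  split_ifs
  exacts [min_le_right _ _, le_rfl]

theorem leave_le_lb_of_ahead (hJ : J ∈ I.safeIntervals H i q) (hQ : H j = some Q)
    (hr : r ≤ I.len j) (hpath : I.path j r = I.path i q) (hji : I.Ahead j i) :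
    I.leave j Q r ≤ J.lb := by
  obtain ⟨hearliest, hlt, havoid⟩ := of_mem_safeIntervals hJ
  have hmem := mem_blocks hQ hr hpath
  rw [if_pos hji] at hmem
  refine (havoid _ hmem).resolve_left fun hub => hlt.not_ge (hub.trans (WithTop.coe_le_coe.2 ?_))
  exact (min_le_left _ _).trans hearliest

end SafeIntervals

/-- Agent `i` with the trajectory `P` keeps clear of agent `j` with the trajectory `Q`: they do not
collide, and `i` does not overtake `j`. -/
def Clear (I : Intersection V ι K) (j : ι) (Q : Profile) (i : ι) (P : Profile) : Prop :=
  ∀ r ≤ I.len j, ∀ q ≤ I.len i, I.path j r = I.path i q →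
    (I.leave i P q ≤ I.reach j Q r ∨ I.leave j Q r ≤ I.reach i P q) ∧
    (I.Ahead j i → I.leave j Q r ≤ I.reach i P q)

/-- A feasible trajectory of agent `i` that keeps clear of the agents whose trajectories are given
by `H`. -/
def Valid (I : Intersection V ι K) (H : ι → Option Profile) (i : ι) (P : Profile) : Prop :=
  I.IsKinodynamic i P ∧ ∀ j, ∀ Q ∈ H j, I.Clear j Q i P

/-- The intervals of a node lie within safe intervals. -/
def Fits (I : Intersection V ι K) (H : ι → Option Profile) (i : ι) (N : SIPPNode) : Prop :=
  N.depth ≤ I.len i ∧ ∀ q ≤ N.depth, ∃ J ∈ I.safeIntervals H i q, (N.ivl q).Within J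

theorem Fits.valid (hN : I.Fits H i N) (hdepth : N.depth = I.len i) {T : ℝ} {P : Profile}
    (hP : I.IsZeroSlack n i N.ivl T P) : I.Valid H i P := by
  have hearliest : I.earliest i ≤ (N.ivl 0).lb := by
    obtain ⟨J, hJ, hw⟩ := hN.2 0 (Nat.zero_le _)
    exact (of_mem_safeIntervals hJ).1.trans hw.1
  refine ⟨hP.isKinodynamic hearliest, fun j Q hQ r hr q hq hpath => ?_⟩
  obtain ⟨J, hJ, hw⟩ := hN.2 q (hq.trans_eq hdepth.symm)
  have hreach := hP.lb_le_reach hearliest hq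
  constructor
  · refine ((avoids_of_mem_safeIntervals hJ hQ hr hpath).mono hw).imp (fun hub => ?_)
      fun hlb => hlb.trans hreach
    exact WithTop.coe_le_coe.1 ((hP.leave_le_ub hq).trans hub)
  · exact fun hji => (leave_le_lb_of_ahead hJ hQ hr hpath hji).trans (hw.1.trans hreach)

theorem of_mem_expand (h : N' ∈ I.expand H i N) :
    N'.depth = N.depth + 1 ∧ (∀ q ≤ N.depth, N'.ivl q = N.ivl q) ∧
      ∃ J ∈ I.safeIntervals H i (N.depth + 1), (N'.ivl (N.depth + 1)).Within J := by
  obtain ⟨J, hJ, hext⟩ := List.mem_filterMap.1 (Multiset.mem_coe.1 h)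
  simp only [extend, Option.ite_none_right_eq_some, Option.some.injEq] at hext
  obtain ⟨-, rfl⟩ := hext
  refine ⟨rfl, fun q hq => Function.update_of_ne (by omega) _ _, J, hJ, ?_⟩
  simp only [Function.update_self]
  exact ⟨le_max_left _ _, min_le_left _ _⟩

theorem Fits.of_mem_expand (hN : I.Fits H i N) (hlt : N.depth < I.len i)
    (h : N' ∈ I.expand H i N) : I.Fits H i N' := by
  obtain ⟨hdepth, hold, hnew⟩ := Intersection.of_mem_expand h
  rw [Fits, hdepth]
  refine ⟨hlt, fun q hq => ?_⟩
  rcases hq.lt_or_eq with hq | rfl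
  · rw [hold q (Nat.le_of_lt_succ hq)]
    exact hN.2 q (Nat.le_of_lt_succ hq)
  · exact hnew

theorem exists_unbounded_mem_expand (I : Intersection V ι K) (H : ι → Option Profile) (i : ι)
    (hN : UnboundedUpTo N.ivl N.depth) :
    ∃ N' ∈ I.expand H i N, UnboundedUpTo N'.ivl N'.depth := by
  obtain ⟨J, hJ, htop⟩ := I.exists_top_mem_safeIntervals H i (N.depth + 1)
  have hub : ∀ d : WithTop ℝ, min J.ub ((N.ivl N.depth).ub + d) = ⊤ := fun d => by
    rw [htop, hN _ le_rfl, WithTop.top_add, min_self]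
  have hext : I.extend i N J = some _ := if_pos (by rw [hub]; exact WithTop.coe_lt_top _)
  refine ⟨_, Multiset.mem_coe.2 (List.mem_filterMap.2 ⟨J, hJ, hext⟩), fun q hq => ?_⟩
  rcases hq.lt_or_eq with hq | rfl
  · simpa only [Function.update_of_ne hq.ne] using hN q (Nat.le_of_lt_succ hq)
  · simpa only [Function.update_self] using hub _

end Intersection

theorem mem_of_mem_keepBest {best r : Option Profile} {P : Profile} (h : P ∈ keepBest best r) :
    P ∈ best ∨ P ∈ r := by
  rcases r with _ | Q
  · exact Or.inl h
  · simp only [keepBest] at h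
    split_ifs at h
    exacts [Or.inr h, Or.inl h]

theorem eq_none_of_keepBest_eq_none {best r : Option Profile} (h : keepBest best r = none) :
    best = none ∧ r = none := by
  rcases r with _ | Q
  · exact ⟨h, rfl⟩
  · simp only [keepBest] at h
    split_ifs at h with himp
    exact absurd (h ▸ trivial) himp

/-- The nodes in a state of Level 2 lie within safe intervals, and its profiles are valid. -/
def SIPPState.Sound (I : Intersection V ι K) (n : ℕ) (H : ι → Option Profile) (i : ι) :
    SIPPState → Prop
  | search opn best => (∀ N ∈ opn, I.Fits H i N) ∧ ∀ P ∈ best, I.Valid H i P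
  | level3 opn best N b => (∀ N ∈ opn, I.Fits H i N) ∧ (∀ P ∈ best, I.Valid H i P) ∧
      I.Fits H i N ∧ N.depth = I.len i ∧ b.Sound I n i N.ivl
  | done r => ∀ P ∈ r, I.Valid H i P

theorem SIPPState.sound_init (I : Intersection V ι K) (n : ℕ) (H : ι → Option Profile) (i : ι) :
    (SIPPState.init I H i).Sound I n H i := by
  refine ⟨fun N hN => ?_, fun P hP => nomatch hP⟩
  obtain ⟨J, hJ, rfl⟩ := List.mem_map.1 (Multiset.mem_coe.1 hN)
  refine ⟨Nat.zero_le _, fun q hq => ?_⟩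
  obtain rfl : q = 0 := Nat.le_zero.1 hq
  exact ⟨J, hJ, .refl J⟩

theorem SIPPStep.sound {s s' : SIPPState} (h : SIPPStep I n ε Δ H i s s')
    (hs : s.Sound I n H i) : s'.Sound I n H i := by
  cases h with
  | finish => exact hs.2
  | expand opn best N _ _ hlt =>
    obtain ⟨hopn, hbest⟩ := hs
    rw [Multiset.forall_mem_cons] at hopn
    refine ⟨fun N' hN' => ?_, hbest⟩
    exact (Multiset.mem_add.1 hN').elim (hopn.2 N') (hopn.1.of_mem_expand hlt)
  | call opn best N _ _ hlen =>
    obtain ⟨hopn, hbest⟩ := hs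
    rw [Multiset.forall_mem_cons] at hopn
    exact ⟨hopn.2, hbest, hopn.1, hlen, trivial⟩
  | inner opn best N b b' hb =>
    obtain ⟨hopn, hbest, hN, hlen, hsound⟩ := hs
    exact ⟨hopn, hbest, hN, hlen, hb.sound hsound⟩
  | ret opn best N r =>
    obtain ⟨hopn, hbest, hN, hlen, hsound⟩ := hs
    refine ⟨hopn, fun P hP => ?_⟩
    rcases mem_of_mem_keepBest hP with hP | hP
    · exact hbest P hP
    · obtain ⟨T, hT⟩ := hsound P hP
      exact hN.valid hlen hT

/-- Invariant of Level 2: as long as no profile has been found, a node with unbounded intervals is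
open or handled by Level 3; the search cannot end without a profile. -/
def SIPPState.Live (I : Intersection V ι K) (ε : ℝ) (i : ι) : SIPPState → Prop
  | search opn best => best = none → ∃ N ∈ opn, UnboundedUpTo N.ivl N.depth
  | level3 opn best N b => best = none → (∃ N ∈ opn, UnboundedUpTo N.ivl N.depth) ∨
      UnboundedUpTo N.ivl (I.len i) ∧ b.Live I ε i N.ivl
  | done r => r ≠ none

theorem SIPPState.live_init (I : Intersection V ι K) (ε : ℝ) (H : ι → Option Profile) (i : ι) :
    (SIPPState.init I H i).Live I ε i := by
  intro _
  obtain ⟨J, hJ, htop⟩ := I.exists_top_mem_safeIntervals H i 0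
  exact ⟨_, Multiset.mem_coe.2 (List.mem_map.2 ⟨J, hJ, rfl⟩), fun _ _ => htop⟩

theorem SIPPStep.live (hn : n ≠ 0) (hε : 0 < ε) (hεL : ε < I.length i / I.lo i 1) (hΔ : 0 ≤ Δ)
    {s s' : SIPPState} (h : SIPPStep I n ε Δ H i s s') (hs : s.Live I ε i) : s'.Live I ε i := by
  cases h with
  | finish opn best hno =>
    rintro rfl
    obtain ⟨N, hN, -⟩ := hs rfl
    exact hno N hN trivial
  | expand opn best N =>
    intro hnone
    obtain ⟨N', hN', hub⟩ := hs hnone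
    rcases Multiset.mem_cons.1 hN' with rfl | hN'
    · obtain ⟨N'', hN'', hub'⟩ := I.exists_unbounded_mem_expand H i hub
      exact ⟨N'', Multiset.mem_add.2 (Or.inr hN''), hub'⟩
    · exact ⟨N', Multiset.mem_add.2 (Or.inl hN'), hub⟩
  | call opn best N _ _ hlen =>
    intro hnone
    obtain ⟨N', hN', hub⟩ := hs hnone
    rcases Multiset.mem_cons.1 hN' with rfl | hN'
    · exact Or.inr ⟨hlen ▸ hub, trivial⟩
    · exact Or.inl ⟨N', hN', hub⟩
  | inner opn best N b b' hb =>
    exact fun hnone => (hs hnone).imp_right fun h => ⟨h.1, hb.live hn hε hεL hΔ h.1 h.2⟩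
  | ret opn best N r =>
    intro hnone
    obtain ⟨hbest, hr⟩ := eq_none_of_keepBest_eq_none hnone
    exact (hs hbest).resolve_right fun h => h.2 hr

theorem SIPPState.exists_step {s : SIPPState} (hs : s.Sound I n H i) :
    (∃ r, s = .done r) ∨ ∃ s', SIPPStep I n ε Δ H i s s' := by
  rcases s with ⟨opn, best⟩ | ⟨opn, best, N, b⟩ | r
  · right
    by_cases! hall : ∀ N ∈ opn, ¬ Improves best (I.fValue i N)
    · exact ⟨_, .finish _ _ hall⟩
    obtain ⟨N₁, hN₁, himp⟩ := hall
    obtain ⟨N, hN, hmin⟩ := Set.exists_min_image {N | N ∈ opn} (I.fValue i)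
      (Multiset.finite_toSet opn) ⟨N₁, hN₁⟩
    have himpN : Improves best (I.fValue i N) := by
      rcases best with _ | P
      exacts [trivial, (hmin N₁ hN₁).trans_lt himp]
    obtain ⟨opn, rfl⟩ := Multiset.exists_cons_of_mem hN
    have hmin' : ∀ N' ∈ opn, I.fValue i N ≤ I.fValue i N' :=
      fun N' hN' => hmin N' (Multiset.mem_cons_of_mem hN')
    rcases (hs.1 N hN).1.lt_or_eq with hlt | heq
    exacts [⟨_, .expand _ _ _ hmin' himpN hlt⟩, ⟨_, .call _ _ _ hmin' himpN heq⟩]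
  · right
    rcases b.exists_step (I := I) (n := n) (ε := ε) (Δ := Δ) (i := i) (S := N.ivl) with
      ⟨r, rfl⟩ | ⟨b', hb'⟩
    exacts [⟨_, .ret _ _ _ _⟩, ⟨_, .inner _ _ _ _ _ hb'⟩]
  · exact Or.inl ⟨r, rfl⟩

theorem SIPPState.acc_level3 (hε : 0 < ε) {opn : Multiset SIPPNode}
    (hopn : ∀ best, Acc (flip (SIPPStep I n ε Δ H i)) (.search opn best)) (best : Option Profile)
    (N : SIPPNode) (b : BCPState) :
    Acc (flip (SIPPStep I n ε Δ H i)) (.level3 opn best N b) := by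
  induction BCPState.acc (I := I) (n := n) (Δ := Δ) (i := i) (S := N.ivl) hε b with
  | intro b _ ih =>
    refine ⟨_, fun s h => ?_⟩
    cases h with
    | inner _ _ _ _ b' hb => exact ih b' hb
    | ret => exact hopn _

-- Expanding a node replaces it by finitely many nodes that are closer to the goal.
theorem SIPPState.acc_search (hε : 0 < ε) (opn : Multiset SIPPNode) (best : Option Profile) :
    Acc (flip (SIPPStep I n ε Δ H i)) (.search opn best) := by
  have hwf : WellFounded (InvImage (· < ·) fun N : SIPPNode => I.len i - N.depth) :=
    InvImage.wf _ wellFounded_lt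
  induction opn using hwf.cutExpand.induction generalizing best with
  | _ opn ih =>
    refine ⟨_, fun s h => ?_⟩
    cases h with
    | finish => exact ⟨_, fun _ h => nomatch h⟩
    | expand opn _ N _ _ hlt =>
      refine ih _ ⟨I.expand H i N, N, fun N' hN' => ?_, ?_⟩ _
      · have hdepth := (Intersection.of_mem_expand hN').1
        change I.len i - N'.depth < I.len i - N.depth
        omega
      · rw [add_right_comm, add_comm opn {N}, Multiset.singleton_add]
    | call opn _ N =>
      refine acc_level3 hε (fun _ => ih _ ⟨0, N, by simp, ?_⟩ _) _ _ _
      rw [add_zero, add_comm, Multiset.singleton_add]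

theorem SIPPState.acc (hε : 0 < ε) : ∀ s : SIPPState, Acc (flip (SIPPStep I n ε Δ H i)) s
  | search opn best => acc_search hε opn best
  | level3 _ best N b => acc_level3 hε (acc_search hε _) best N b
  | done _ => ⟨_, fun _ h => nomatch h⟩

end Level2

/-! ### Level 1: priority orderings and the search of the priority tree -/

section Level1

open Relation (TransGen ReflTransGen)

section Orderings

variable {ι : Type*} {o : ι → ι → Prop} {i j a b : ι}

theorem transGen_addOrder (h : TransGen (addOrder o i j) a b) :
    TransGen o a b ∨ ReflTransGen o a i ∧ ReflTransGen o j b := by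
  induction h with
  | single h =>
    rcases h with h | ⟨rfl, rfl⟩
    exacts [Or.inl (.single h), Or.inr ⟨.refl, .refl⟩]
  | tail _ h ih =>
    rcases h with h | ⟨rfl, rfl⟩
    · exact ih.imp (fun h' => h'.tail h) fun h' => ⟨h'.1, h'.2.tail h⟩
    · exact Or.inr ⟨ih.elim TransGen.to_reflTransGen And.left, .refl⟩

/-- The pairs of agents that the orderings `o` leave open, as a measure of the depth to which the
priority tree can grow below a node. -/
def unordered (o : ι → ι → Prop) : Set (ι × ι) := {p | ¬ TransGen o p.1 p.2}

theorem unordered_addOrder_ssubset (h : ¬ TransGen o i j) :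
    unordered (addOrder o i j) ⊂ unordered o := by
  refine ⟨fun p hp hop => hp (TransGen.mono (fun _ _ => Or.inl) _ _ hop), fun hsub => ?_⟩
  exact hsub (a := (i, j)) h (.single (Or.inr ⟨rfl, rfl⟩))

theorem higher_update [DecidableEq ι] {pl : ι → Option Profile} (h : ¬ TransGen o i a)
    (p : Option Profile) : higher o (Function.update pl i p) a = higher o pl a := by
  funext j
  simp only [higher]
  split_ifs with hja
  · exact Function.update_of_ne (by rintro rfl; exact h hja) _ _
  · rfl

end Orderings

variable {V ι : Type*} {K : ℕ} {I : Intersection V ι K} {o : ι → ι → Prop} {i j : ι}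
  {pl : ι → Option Profile} {N : PTNode ι}

/-- Acyclic orderings that contain those of the agents from the same entry lane. -/
structure Admissible (I : Intersection V ι K) (o : ι → ι → Prop) : Prop where
  ahead : ∀ i j, I.Ahead i j → o i j
  acyclic : ∀ i, ¬ TransGen o i i

theorem admissible_ahead (I : Intersection V ι K) : Admissible I I.Ahead := by
  refine ⟨fun _ _ h => h, fun i h => ?_⟩
  have hlt : TransGen (· < ·) (I.earliest i) (I.earliest i) := h.lift _ fun _ _ h => h.2
  rw [Relation.transGen_eq_self] at hlt
  exact lt_irrefl _ hlt

theorem Admissible.addOrder (ho : Admissible I o) (hij : i ≠ j) (h : ¬ TransGen o j i) :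
    Admissible I (addOrder o i j) := by
  refine ⟨fun a b hab => Or.inl (ho.ahead a b hab), fun a ha => ?_⟩
  rcases transGen_addOrder ha with ha | ⟨hai, hja⟩
  · exact ho.acyclic a ha
  · rcases Relation.reflTransGen_iff_eq_or_transGen.1 (hja.trans hai) with heq | hji
    exacts [hij heq, h hji]

/-- Each trajectory of the partial plan `pl` was found after those of all agents of higher
priority, and is valid with respect to them. -/
def PlanSound (I : Intersection V ι K) (o : ι → ι → Prop) (pl : ι → Option Profile) : Prop :=
  ∀ i, ∀ P ∈ pl i, (∀ j, TransGen o j i → pl j ≠ none) ∧ I.Valid (higher o pl i) i P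

theorem PlanSound.update [DecidableEq ι] (hpl : PlanSound I o pl) (ho : Admissible I o)
    (hi : pl i = none) (hj : ∀ j, TransGen o j i → pl j ≠ none) {P : Profile}
    (hP : I.Valid (higher o pl i) i P) : PlanSound I o (Function.update pl i (some P)) := by
  intro a Q hQ
  have hstep : ¬ TransGen o i a ∧ (∀ j, TransGen o j a → pl j ≠ none) ∧
      I.Valid (higher o pl a) a Q := by
    rcases eq_or_ne a i with rfl | hai
    · obtain rfl : P = Q := by simpa using hQ
      exact ⟨ho.acyclic a, hj, hP⟩
    · rw [Function.update_of_ne hai] at hQ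
      exact ⟨fun hia => (hpl a Q hQ).1 i hia hi, hpl a Q hQ⟩
  obtain ⟨hia, hknown, hvalid⟩ := hstep
  refine ⟨fun j hja => ?_, by rwa [higher_update hia]⟩
  rw [Function.update_of_ne (by rintro rfl; exact hia hja)]
  exact hknown j hja

/-- The invariant of the nodes of the priority tree. -/
structure PTNode.Sound (I : Intersection V ι K) (N : PTNode ι) : Prop where
  admissible : Admissible I N.order
  plan : PlanSound I N.order fun i => some (N.traj i)

namespace PTNode.Sound

theorem isKinodynamic (hN : N.Sound I) (i : ι) : I.IsKinodynamic i (N.traj i) :=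
  (hN.plan i _ rfl).2.1

theorem clear (hN : N.Sound I) (h : TransGen N.order j i) :
    I.Clear j (N.traj j) i (N.traj i) :=
  (hN.plan i _ rfl).2.2 j _ (if_pos h)

theorem not_transGen (hN : N.Sound I) (h : I.Collide N.traj i j) : ¬ TransGen N.order i j := by
  intro hij
  obtain ⟨-, q, hq, r, hr, hpath, hmeet⟩ := h
  refine hmeet (Set.Ico_disjoint_Ico.2 ?_)
  exact (hN.clear hij q hq r hr hpath).1.elim
    (fun h => (min_le_right _ _).trans (h.trans (le_max_left _ _)))
    fun h => (min_le_left _ _).trans (h.trans (le_max_right _ _))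

theorem isSolution (hN : N.Sound I) (h : ∀ i j, ¬ I.Collide N.traj i j) :
    I.IsSolution N.traj := by
  refine ⟨hN.isKinodynamic, h, fun i j ⟨hahead, q, hq, r, hr, hpath, hle⟩ => ?_⟩
  have hclear := (hN.clear (.single (hN.admissible.ahead i j hahead)) q hq r hr hpath).2 hahead
  exact (((hN.isKinodynamic i).reach_lt_leave q).trans_le (hclear.trans hle)).false

end PTNode.Sound

theorem Intersection.Collide.symm {traj : ι → Profile} (h : I.Collide traj i j) :
    I.Collide traj j i := by
  obtain ⟨hij, q, hq, r, hr, hpath, hmeet⟩ := h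
  exact ⟨hij.symm, r, hr, q, hq, hpath.symm, fun h => hmeet h.symm⟩

/-- The invariant of the data that PSB keeps: nodes to be visited, nodes just generated, and
orderings for which a node is still to be generated. -/
structure QueueSound (I : Intersection V ι K) (stack ready : List (PTNode ι))
    (todo : List (ι → ι → Prop)) : Prop where
  stack : ∀ N ∈ stack, N.Sound I
  ready : ∀ N ∈ ready, N.Sound I
  todo : ∀ o ∈ todo, Admissible I o

variable [Fintype ι] {n : ℕ} {ε Δ : ℝ} {σ σ' : State ι}

/-- The invariant of PSB by which the trajectories it returns are a solution. -/
def State.Sound (I : Intersection V ι K) (n : ℕ) : State ι → Prop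
  | search stack => ∀ N ∈ stack, N.Sound I
  | siblings stack ready todo => QueueSound I stack ready todo
  | plan stack ready todo o pl => QueueSound I stack ready (o :: todo) ∧ PlanSound I o pl
  | level2 stack ready todo o pl i s => QueueSound I stack ready (o :: todo) ∧ PlanSound I o pl ∧
      pl i = none ∧ (∀ j, TransGen o j i → pl j ≠ none) ∧ s.Sound I n (higher o pl i) i
  | solved traj => I.IsSolution traj
  | failed => True

theorem State.sound_init (I : Intersection V ι K) (n : ℕ) : (State.init I).Sound I n :=
  ⟨by simp, by simp, by simpa using admissible_ahead I⟩

open Classical in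
theorem Step.sound (h : Step I n ε Δ σ σ') (hσ : σ.Sound I n) : σ'.Sound I n := by
  cases h with
  | fail => trivial
  | success N stack hno => exact (hσ N List.mem_cons_self).isSolution hno
  | branch N stack i j hc =>
    obtain ⟨hN, hstack⟩ := List.forall_mem_cons.1 hσ
    refine ⟨hstack, by simp, ?_⟩
    simp only [List.forall_mem_cons, List.not_mem_nil, false_implies, implies_true, and_true]
    exact ⟨hN.admissible.addOrder hc.1 (hN.not_transGen hc.symm),
      hN.admissible.addOrder hc.1.symm (hN.not_transGen hc)⟩
  | push stack ready l hl =>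
    exact List.forall_mem_append.2 ⟨fun N hN => hσ.ready N (hl.mem_iff.1 hN), hσ.stack⟩
  | generate => exact ⟨hσ, fun i P hP => nomatch hP⟩
  | cyclic => exact ⟨hσ.stack, hσ.ready, (List.forall_mem_cons.1 hσ.todo).2⟩
  | call stack ready todo o pl i hi hj =>
    exact ⟨hσ.1, hσ.2, hi, hj, SIPPState.sound_init I n _ i⟩
  | inner stack ready todo o pl i s s' hs =>
    obtain ⟨hqueue, hpl, hi, hj, hsound⟩ := hσ
    exact ⟨hqueue, hpl, hi, hj, hs.sound hsound⟩
  | planned stack ready todo o pl i P =>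
    obtain ⟨hqueue, hpl, hi, hj, hsound⟩ := hσ
    exact ⟨hqueue, hpl.update (hqueue.todo o List.mem_cons_self) hi hj (hsound P rfl)⟩
  | discard => exact ⟨hσ.1.stack, hσ.1.ready, (List.forall_mem_cons.1 hσ.1.todo).2⟩
  | generated =>
    obtain ⟨hqueue, hpl⟩ := hσ
    obtain ⟨ho, htodo⟩ := List.forall_mem_cons.1 hqueue.todo
    exact ⟨hqueue.stack, List.forall_mem_cons.2 ⟨⟨ho, hpl⟩, hqueue.ready⟩, htodo⟩

/-- The invariant of PSB by which it does not fail: there is always a node left. -/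
def State.Live (I : Intersection V ι K) (ε : ℝ) : State ι → Prop
  | search stack => stack ≠ []
  | siblings _ ready todo => ready ≠ [] ∨ todo ≠ []
  | plan .. => True
  | level2 _ _ _ _ _ i s => s.Live I ε i
  | solved _ => True
  | failed => False

theorem Step.live (hn : n ≠ 0) (hε : 0 < ε) (hεL : ∀ i, ε < I.length i / I.lo i 1) (hΔ : 0 ≤ Δ)
    (h : Step I n ε Δ σ σ') (hσ : σ.Sound I n) (hlive : σ.Live I ε) : σ'.Live I ε := by
  cases h with
  | fail => exact hlive rfl
  | branch => exact Or.inr (List.cons_ne_nil _ _)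
  | push stack ready l hl =>
    intro happend
    obtain ⟨rfl, -⟩ := List.append_eq_nil_iff.1 happend
    exact hlive.elim (fun hready => hready hl.nil_eq.symm) fun htodo => htodo rfl
  | cyclic _ _ o _ i hi => exact ((hσ.todo o List.mem_cons_self).acyclic i hi).elim
  | call _ _ _ _ _ i => exact SIPPState.live_init I ε _ i
  | inner _ _ _ _ _ i _ _ hs => exact hs.live hn hε (hεL i) hΔ hlive
  | discard => exact (hlive rfl).elim
  | generated => exact Or.inl (List.cons_ne_nil _ _)
  | success | generate | planned => trivial

theorem State.exists_step (hσ : σ.Sound I n) :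
    (∃ traj, σ = .solved traj) ∨ σ = .failed ∨ ∃ σ', Step I n ε Δ σ σ' := by
  rcases σ with stack | ⟨stack, ready, _ | ⟨o, todo⟩⟩ | ⟨stack, ready, todo, o, pl⟩ |
    ⟨stack, ready, todo, o, pl, i, s⟩ | traj | _
  · rcases stack with _ | ⟨N, stack⟩
    · exact Or.inr (Or.inr ⟨_, .fail⟩)
    by_cases! hno : ∀ i j, ¬ I.Collide N.traj i j
    · exact Or.inr (Or.inr ⟨_, .success _ _ hno⟩)
    · obtain ⟨i, j, hc⟩ := hno
      exact Or.inr (Or.inr ⟨_, .branch _ _ i j hc⟩)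
  · exact Or.inr (Or.inr ⟨_, .push _ _ _ (List.Perm.refl _)⟩)
  · exact Or.inr (Or.inr ⟨_, .generate _ _ _ _ (hσ.todo o List.mem_cons_self).acyclic⟩)
  · by_cases! hnone : ∃ i, pl i = none
    · have : Std.Irrefl (TransGen o) := ⟨(hσ.1.todo o List.mem_cons_self).acyclic⟩
      obtain ⟨i, hi, hmin⟩ :=
        (Finite.wellFounded_of_trans_of_irrefl (TransGen o)).has_min {i | pl i = none} hnone
      exact Or.inr (Or.inr ⟨_, .call _ _ _ _ _ i hi fun j hj hnone => hmin j hnone hj⟩)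
    · choose traj htraj using fun i => Option.ne_none_iff_exists'.1 (hnone i)
      obtain rfl : pl = fun i => some (traj i) := funext htraj
      exact Or.inr (Or.inr ⟨_, .generated _ _ _ _ _⟩)
  · rcases SIPPState.exists_step (ε := ε) (Δ := Δ) hσ.2.2.2.2 with ⟨_ | P, rfl⟩ | ⟨s', hs'⟩
    · exact Or.inr (Or.inr ⟨_, .discard _ _ _ _ _ _⟩)
    · exact Or.inr (Or.inr ⟨_, .planned _ _ _ _ _ _ _⟩)
    · exact Or.inr (Or.inr ⟨_, .inner _ _ _ _ _ _ _ _ hs'⟩)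
  · exact Or.inl ⟨traj, rfl⟩
  · exact Or.inr (Or.inl rfl)

/-- The converse of the step relation of PSB, restricted to sound states. -/
def RevStep (I : Intersection V ι K) (n : ℕ) (ε Δ : ℝ) (σ' σ : State ι) : Prop :=
  σ.Sound I n ∧ Step I n ε Δ σ σ'

namespace State

variable {stack ready : List (PTNode ι)} {todo : List (ι → ι → Prop)}

open Classical in
theorem acc_level2 (hε : 0 < ε) (hdiscard : Acc (RevStep I n ε Δ) (.siblings stack ready todo))
    (hplanned : ∀ P, Acc (RevStep I n ε Δ)
      (.plan stack ready todo o (Function.update pl i (some P)))) (s : SIPPState) :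
    Acc (RevStep I n ε Δ) (.level2 stack ready todo o pl i s) := by
  induction SIPPState.acc (I := I) (n := n) (Δ := Δ) (i := i) (H := higher o pl i) hε s with
  | intro s _ ih =>
    refine ⟨_, fun σ ⟨_, h⟩ => ?_⟩
    cases h with
    | inner _ _ _ _ _ _ _ s' hs => exact ih s' hs
    | discard => exact hdiscard
    | planned _ _ _ _ _ _ P => exact hplanned P

theorem acc_plan (hε : 0 < ε) (hdiscard : Acc (RevStep I n ε Δ) (.siblings stack ready todo))
    (hgenerated : ∀ traj, Acc (RevStep I n ε Δ) (.siblings stack (⟨o, traj⟩ :: ready) todo))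
    (pl : ι → Option Profile) : Acc (RevStep I n ε Δ) (.plan stack ready todo o pl) := by
  classical
  induction hopen : {i | pl i = none} using WellFoundedLT.induction generalizing pl with
  | _ A ih =>
    subst hopen
    refine ⟨_, fun σ ⟨_, h⟩ => ?_⟩
    cases h with
    | generated => exact hgenerated _
    | call _ _ _ _ _ i hi =>
      refine acc_level2 hε hdiscard (fun P => ih _ ?_ _ rfl) _
      refine Set.ssubset_iff_of_subset (fun a ha => ?_) |>.2 ⟨i, hi, by simp⟩
      have hai : a ≠ i := by
        rintro rfl
        simp at ha
      simpa [hai] using ha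

theorem acc_siblings (hε : 0 < ε) {p : (ι → ι → Prop) → Prop}
    (hpush : ∀ l : List (PTNode ι), (∀ N ∈ l, p N.order) →
      Acc (RevStep I n ε Δ) (.search (l ++ stack)))
    (htodo : ∀ o ∈ todo, p o) (hready : ∀ N ∈ ready, p N.order) :
    Acc (RevStep I n ε Δ) (.siblings stack ready todo) := by
  induction todo generalizing ready with
  | nil =>
    refine ⟨_, fun σ ⟨_, h⟩ => ?_⟩
    cases h with
    | push _ _ l hl => exact hpush l fun N hN => hready N (hl.mem_iff.1 hN)
  | cons o todo ih =>
    obtain ⟨ho, htodo⟩ := List.forall_mem_cons.1 htodo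
    refine ⟨_, fun σ ⟨_, h⟩ => ?_⟩
    cases h with
    | cyclic => exact ih htodo hready
    | generate =>
      exact acc_plan hε (ih htodo hready)
        (fun traj => ih htodo (List.forall_mem_cons.2 ⟨ho, hready⟩)) _

theorem acc_search_append {l : List (PTNode ι)}
    (h : ∀ N ∈ l, ∀ stack, Acc (RevStep I n ε Δ) (.search stack) →
      Acc (RevStep I n ε Δ) (.search (N :: stack)))
    (hstack : Acc (RevStep I n ε Δ) (.search stack)) :
    Acc (RevStep I n ε Δ) (.search (l ++ stack)) := by
  induction l with
  | nil => exact hstack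
  | cons N l ih =>
    rw [List.forall_mem_cons] at h
    exact h.1 _ (ih h.2)

theorem acc_search_cons (hε : 0 < ε) (N : PTNode ι) (stack : List (PTNode ι))
    (hstack : Acc (RevStep I n ε Δ) (.search stack)) :
    Acc (RevStep I n ε Δ) (.search (N :: stack)) := by
  induction hopen : unordered N.order using WellFoundedLT.induction generalizing N stack with
  | _ A ih =>
    subst hopen
    refine ⟨_, fun σ ⟨hsound, h⟩ => ?_⟩
    cases h with
    | success => exact ⟨_, fun σ ⟨_, h⟩ => nomatch h⟩
    | branch _ _ i j hc =>
      have hN := hsound N List.mem_cons_self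
      refine acc_siblings (p := fun o => unordered o < unordered N.order) hε
        (fun l hl => acc_search_append (fun N' hN' stack h => ih _ (hl N' hN') N' stack h rfl)
          hstack) ?_ (by simp)
      simp only [List.forall_mem_cons, List.not_mem_nil, false_implies, implies_true, and_true]
      exact ⟨unordered_addOrder_ssubset (hN.not_transGen hc),
        unordered_addOrder_ssubset (hN.not_transGen hc.symm)⟩

theorem acc_init (hε : 0 < ε) : Acc (RevStep I n ε Δ) (State.init I) := by
  have hnil : Acc (RevStep I n ε Δ) (.search []) := by
    refine ⟨_, fun σ ⟨_, h⟩ => ?_⟩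
    cases h
    exact ⟨_, fun σ ⟨_, h⟩ => nomatch h⟩
  exact acc_siblings (p := fun _ => True) hε
    (fun l _ => acc_search_append (fun N _ => acc_search_cons hε N) hnil)
    (fun _ _ => trivial) fun _ _ => trivial

theorem sound_of_reachable (h : ReflTransGen (Step I n ε Δ) (State.init I) σ) :
    σ.Sound I n := by
  induction h with
  | refl => exact sound_init I n
  | tail _ h ih => exact h.sound ih

theorem live_of_reachable (hn : n ≠ 0) (hε : 0 < ε) (hεL : ∀ i, ε < I.length i / I.lo i 1)
    (hΔ : 0 ≤ Δ) (h : ReflTransGen (Step I n ε Δ) (State.init I) σ) : σ.Live I ε := by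
  induction h with
  | refl => exact Or.inr (List.cons_ne_nil _ _)
  | tail hreach h ih => exact h.live hn hε hεL hΔ (sound_of_reachable hreach) ih

end State

theorem not_exists_run (hε : 0 < ε) : ¬ ∃ run : ℕ → State ι, run 0 = State.init I ∧
    ∀ k, Step I n ε Δ (run k) (run (k + 1)) := by
  rintro ⟨run, hinit, hrun⟩
  have hsound : ∀ k, (run k).Sound I n := by
    intro k
    induction k with
    | zero => exact hinit ▸ State.sound_init I n
    | succ k ih => exact (hrun k).sound ih
  exact not_acc_iff_exists_descending_chain.2 ⟨run, hinit, fun k => ⟨hsound k, hrun k⟩⟩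
    (State.acc_init hε)

end Level1

end PSB

/-- On the intersection model every run of PSB is finite, and the state in which it ends holds a
solution. -/
theorem theorem2 {V ι : Type*} [Fintype ι] {K : ℕ} (I : PSB.Intersection V ι K)
    (n : ℕ) (hn : 1 ≤ n) (ε : ℝ) (hε : 0 < ε) (hε' : ∀ i, ε < I.length i / I.lo i 1)
    (Δ : ℝ) (hΔ : 0 < Δ) :
    (¬ ∃ run : ℕ → PSB.State ι, run 0 = PSB.State.init I ∧
      ∀ k, PSB.Step I n ε Δ (run k) (run (k + 1))) ∧
    ∀ σ : PSB.State ι, Relation.ReflTransGen (PSB.Step I n ε Δ) (PSB.State.init I) σ →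
      (∀ σ', ¬ PSB.Step I n ε Δ σ σ') →
      ∃ traj : ι → PSB.Profile, σ = PSB.State.solved traj ∧ I.IsSolution traj := by
  refine ⟨PSB.not_exists_run hε, fun σ hreach hfinal => ?_⟩
  have hsound : σ.Sound I n := PSB.State.sound_of_reachable hreach
  rcases PSB.State.exists_step hsound with ⟨traj, rfl⟩ | rfl | ⟨σ', hstep⟩
  · exact ⟨traj, rfl, hsound⟩
  · exact (PSB.State.live_of_reachable (Nat.one_le_iff_ne_zero.1 hn) hε hε' hΔ.le hreach).elim
  · exact absurd hstep (hfinal σ')
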